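/- **Setting.** Let $J,K\ge 1$. A city has locations $j\in\{1,\dots,J\}$ with free-flow travel times $l_1>l_2>\dots>l_J\ge 0$ to the centre and capacities $R_j\ge 0$, and jobs $k\in\{1,\dots,K\}$ with labour demands $Q_k\ge 0$, where $\sum_j R_j=\sum_k Q_k=:Q$. All users pass a bottleneck of capacity $\mu>0$; put $T:=Q/\mu$. The commuting disutility of a user who lives at $j$, has job $k$ and leaves the bottleneck at time $s$ is $$c_{j,k}(s)=\alpha_k l_j+\beta_k f(s)+\gamma_k g(s-l_j),$$ where $0<\alpha_1<\dots<\alpha_K$, $0<\beta_1<\dots<\beta_K$, $0<\gamma_1<\dots<\gamma_K$; $f$ is real-valued, nonnegative and continuous on $(-\infty,0]$ with $f'<0$ on $(-\infty,0)$, and $f=+\infty$ (hence $c_{j,k}=+\infty$) on $(0,\infty)$; $g$ is positive and continuous on $(-\infty,-l_J]$ with $g'<0$ and $g''<0$ on $(-\infty,-l_J)$. Let the time horizon $\mathcal S\subseteq\mathbb R$ be a measurable set containing $[-T,0]$. [3D-LP($\mathbf x$)] is the problem of minimizing $$Z(\mathbf x)=\sum_{j,k}\int_{\mathcal S}c_{j,k}(s)\,x_{j,k}(s)\,ds$$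 over measurable $x_{j,k}:\mathcal S\to[0,\infty)$ subject to $\sum_{j,k}x_{j,k}(s)\le\mu$ for almost every $s\in\mathcal S$, $\sum_k\int_{\mathcal S}x_{j,k}\,ds\le R_j$ for all $j$, and $\sum_j\int_{\mathcal S}x_{j,k}\,ds\ge Q_k$ for all $k$. Its transport form is the problem of minimizing $\int c\,dF$ over the (distribution functions $F$ of) measures on $[1,J]\times[1,K]\times[-T,0]$ with, for all $\zeta\in[1,J]$, $\kappa\in[1,K]$, $s\in[-T,0]$, $F(\zeta,K,0)=\sum_{j'\le\zeta}R_{j'}$, $F(J,\kappa,0)=\sum_{k'\le\kappa}Q_{k'}$ and $F(J,K,s)=\mu\,(T+s)$, where $c$ is any real function with $c(j,k,s)=c_{j,k}(s)$ for all $j$, $k$ and $s\in[-T,0]$. **Proposition.** [3D-LP($\mathbf x$)] has an optimal solution, which is unique up to equality almost everywhere on $\mathcal S$. The transport form, for every such $c$, also has exactly one optimal solution. Both are given by the three-dimensional Fréchet–Hoeffding distribution: the distribution function $F^*(\zeta,\kappa,s)$, which for the solution $\mathbf x^*$ of [3D-LP($\mathbf x$)] is $\sum_{j\le\zeta}\sum_{k\le\kappa}\int_{-T}^{s}x^*_{j,k}(s')\,ds'$,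 satisfies $$F^*(\zeta,\kappa,s)=\min\Big\{\sum_{j'\le\zeta}R_{j'},\ \sum_{k'\le\kappa}Q_{k'},\ \mu\,(T+s)\Big\}\qquad\text{for all }\zeta\in[1,J],\ \kappa\in[1,K],\ s\in[-T,0].$$ -/

import Mathlib

open Set MeasureTheory
open scoped NNReal ENNReal

noncomputable section

/-- The data of the departure-time / residential-location / job choice model with `J` locations
and `K` types of jobs. Location `j` and job `k` of the mathematical text (numbered from `1`) are
the elements `j - 1 : Fin J` and `k - 1 : Fin K`. -/
structure CommuteModel (J K : ℕ) where
  /-- free-flow travel time between location `j` and the centre -/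
  l : Fin J → ℝ
  /-- maximum number of users living at location `j` -/
  R : Fin J → ℝ≥0
  /-- labour demand of job `k` -/
  Q : Fin K → ℝ≥0
  /-- capacity of the bottleneck -/
  μ : ℝ≥0
  /-- value of travel time -/
  α : Fin K → ℝ
  /-- value of schedule delay -/
  β : Fin K → ℝ
  /-- value of activity at home -/
  γ : Fin K → ℝ
  /-- schedule delay cost; the value `⊤` prohibits late arrivals -/
  f : ℝ → ℝ≥0∞
  /-- early bird cost -/
  g : ℝ → ℝ

namespace CommuteModel

variable {J K : ℕ} (m : CommuteModel J K)

/-- The commuting disutility `c_{j,k}(s) = α_k l_j + β_k f(s) + γ_k g(s - l_j)`. It is `⊤` for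
`s > 0`; for `s ≤ 0` the three terms are nonnegative real numbers under the assumptions below. -/
def disutility (j : Fin J) (k : Fin K) (s : ℝ) : ℝ≥0∞ :=
  ENNReal.ofReal (m.α k * m.l j) + ENNReal.ofReal (m.β k) * m.f s
    + ENNReal.ofReal (m.γ k * m.g (s - m.l j))

/-- The assumptions on the commuting disutility. Locations are numbered by decreasing distance to
the centre, so `⊤ : Fin J` is the closest one. -/
structure Assumption [NeZero J] : Prop where
  l_anti : StrictAnti m.l
  l_nonneg : ∀ j, 0 ≤ m.l j
  α_pos : ∀ k, 0 < m.α k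
  β_pos : ∀ k, 0 < m.β k
  γ_pos : ∀ k, 0 < m.γ k
  α_mono : StrictMono m.α
  β_mono : StrictMono m.β
  γ_mono : StrictMono m.γ
  f_finite : ∀ s ≤ 0, m.f s ≠ ⊤
  f_late : ∀ s > 0, m.f s = ⊤
  f_cont : ContinuousOn m.f (Iic 0)
  f_deriv : ∀ s < 0, deriv (fun s' => (m.f s').toReal) s < 0
  g_pos : ∀ t ≤ -m.l ⊤, 0 < m.g t
  g_cont : ContinuousOn m.g (Iic (-m.l ⊤))
  g_deriv : ∀ t < -m.l ⊤, deriv m.g t < 0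
  g_deriv2 : ∀ t < -m.l ⊤, deriv (deriv m.g) t < 0

/-- The length `T = Q / μ` of the rush period, `Q = ∑ k, Q_k` being the number of users. -/
def T : ℝ := (∑ k, (m.Q k : ℝ)) / m.μ

/-- Feasibility for `[3D-LP(x)]` on the time horizon `S`: `x j k s` is the departure flow rate from
the bottleneck at time `s` of the users living at `j` and having job `k`. -/
structure Feasible (S : Set ℝ) (x : Fin J → Fin K → ℝ → ℝ≥0) : Prop where
  meas : ∀ j k, AEMeasurable (x j k) (volume.restrict S)
  capacity : ∀ᵐ s ∂volume.restrict S, ∑ j, ∑ k, x j k s ≤ m.μ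
  land : ∀ j, ∑ k, ∫⁻ s in S, (x j k s : ℝ≥0∞) ≤ m.R j
  job : ∀ k, (m.Q k : ℝ≥0∞) ≤ ∑ j, ∫⁻ s in S, (x j k s : ℝ≥0∞)

/-- The objective of `[3D-LP(x)]`: the total commuting disutility. -/
def totalDisutility (S : Set ℝ) (x : Fin J → Fin K → ℝ → ℝ≥0) : ℝ≥0∞ :=
  ∑ j, ∑ k, ∫⁻ s in S, m.disutility j k s * x j k s

/-- `x` is an optimal solution of `[3D-LP(x)]`. -/
def IsLPSolution (S : Set ℝ) (x : Fin J → Fin K → ℝ → ℝ≥0) : Prop :=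
  m.Feasible S x ∧ IsMinOn (m.totalDisutility S) {y | m.Feasible S y} x

/-- The indices `i ∈ {1, …, n}` with `i ≤ ζ`. -/
def upTo (n : ℕ) (ζ : ℝ) : Finset (Fin n) :=
  Finset.univ.filter fun i => (i : ℝ) + 1 ≤ ζ

/-- The cumulative distribution function
`F(ζ, κ, s) = ∑_{j ≤ ζ} ∑_{k ≤ κ} ∫_{-T}^{s} x_{j,k}` of a flow pattern. -/
def flowCDF (x : Fin J → Fin K → ℝ → ℝ≥0) (ζ κ s : ℝ) : ℝ≥0∞ :=
  ∑ j ∈ upTo J ζ, ∑ k ∈ upTo K κ, ∫⁻ s' in Icc (-m.T) s, (x j k s' : ℝ≥0∞)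

/-- The three-dimensional Fréchet–Hoeffding distribution function. -/
def frechetHoeffding (ζ κ s : ℝ) : ℝ :=
  min (∑ j ∈ upTo J ζ, (m.R j : ℝ)) (min (∑ k ∈ upTo K κ, (m.Q k : ℝ)) (m.μ * (m.T + s)))

/-- The box `[1, J] × [1, K] × [-T, 0]`. -/
def box : Set (ℝ × ℝ × ℝ) :=
  Icc (1 : ℝ) J ×ˢ Icc (1 : ℝ) K ×ˢ Icc (-m.T) 0

/-- The distribution function of a measure on `ℝ³`. -/
def measCDF (π : Measure (ℝ × ℝ × ℝ)) (ζ κ s : ℝ) : ℝ≥0∞ :=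
  π (Iic ζ ×ˢ Iic κ ×ˢ Iic s)

/-- The measures on the box whose distribution function has the prescribed marginals. -/
structure IsPlan (π : Measure (ℝ × ℝ × ℝ)) : Prop where
  supp : π m.boxᶜ = 0
  land : ∀ ζ ∈ Icc (1 : ℝ) J,
    measCDF π ζ K 0 = ENNReal.ofReal (∑ j ∈ upTo J ζ, (m.R j : ℝ))
  job : ∀ κ ∈ Icc (1 : ℝ) K,
    measCDF π J κ 0 = ENNReal.ofReal (∑ k ∈ upTo K κ, (m.Q k : ℝ))
  time : ∀ s ∈ Icc (-m.T) 0,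
    measCDF π J K s = ENNReal.ofReal (m.μ * (m.T + s))

/-- `π` solves the continuous transport problem with cost function `c`. -/
def IsOTSolution (c : ℝ × ℝ × ℝ → ℝ) (π : Measure (ℝ × ℝ × ℝ)) : Prop :=
  m.IsPlan π ∧
    IsMinOn (fun ρ : Measure (ℝ × ℝ × ℝ) => ∫ p in m.box, c p ∂ρ) {ρ | m.IsPlan ρ} π

/-- `c` extends the disutility, given at the integer points of `[1, J] × [1, K]`. Its other values
do not matter, since every plan is concentrated on the integer points. -/
def Extends (c : ℝ × ℝ × ℝ → ℝ) : Prop :=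
  ∀ (j : Fin J) (k : Fin K), ∀ s ∈ Icc (-m.T) 0,
    c ((j : ℝ) + 1, (k : ℝ) + 1, s) = (m.disutility j k s).toReal

end CommuteModel

end

/-!
The increments of the cost `c_{j,k}(s)` in `j` (locations being numbered by decreasing distance) and
in `k` decrease as the other index grows, and strictly decrease in `s`. This comes from the opposite
monotonicity of `α, β, γ` and of `l, f, g`, and, between location and time, from the strict
concavity of `g`. Hence the cheapest way to match locations, jobs
and times is the comonotone one, in which both the locations and the jobs leave the bottleneck in
order and at full capacity (`stairFlow`); its distribution function is the minimum of the three
marginal ones (`sum_stairFlow_Iic`).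

Optimality is proved by linear programming duality. The prices of locations and jobs add up the
increments of the cost along the staircase of the comonotone matching, each at its jump time. For
these prices the reduced cost at time `s` has its unique minimum at the step of the staircase
occupied at `s`, as some unit step towards it always lowers the reduced cost (`exists_potentials`).
The price of the capacity is the negative part of the minimal reduced cost, normalized to vanish at
`-T`; as the cost is decreasing in time, this price is zero before `-T` (`Assumption.exists_dual`).
Complementary slackness is strict outside the finitely many jump times, which gives uniqueness.

Both problems are special cases of one about families `ν j k` of measures on the time axis with
`∑ ν j k ≤ μ • volume` and prescribed total masses (`IsFlow`, `flowCost_stairFlow`). For the linear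
program, `ν j k` has density `x j k`; the constraints hold with equality because the totals of
supply and demand agree. For the transport problem, the marginals force a plan onto the fibres over
the integer points, and `ν j k` is its part over `(j, k)` (`IsPlan.eq_flowPlan`).
-/

namespace CommuteModel

/-! ### Dual potentials of the discrete staircase -/

theorem lt_count_iff {P : ℕ → Prop} [DecidablePred P] (hP : ∀ i j, i ≤ j → P j → P i) (n i : ℕ) :
    i < Nat.count P n ↔ i < n ∧ P i := by
  induction n with
  | zero => simp
  | succ n ih =>
    rw [Nat.count_succ]
    by_cases hn : P n
    · have hall : Nat.count P n = n := by
        rw [Nat.count_eq_card_filter_range,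
          Finset.filter_true_of_mem fun x hx => hP x n (Finset.mem_range.1 hx).le hn,
          Finset.card_range]
      simp only [hn, if_true, hall]
      exact ⟨fun h => ⟨h, hP i n (by omega) hn⟩, fun h => h.1⟩
    · simp only [hn, if_false, add_zero, ih]
      refine ⟨fun h => ⟨by omega, h.2⟩, fun h => ⟨?_, h.2⟩⟩
      rcases Nat.lt_succ_iff_lt_or_eq.1 h.1 with h' | rfl
      · exact h'
      · exact absurd h.2 hn

open Classical in
/-- If the intervals `(θ i, θ (i + 1)]`, `i < n`, cover the position `s`, this is the index of the
interval containing `s`. The count stops at `n - 1`, so that the value is always below `n`. -/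
noncomputable def stepIndex (θ : ℕ → ℝ) (n : ℕ) (s : ℝ) : ℕ :=
  Nat.count (fun i => θ (i + 1) < s) (n - 1)

theorem stepIndex_lt (θ : ℕ → ℝ) {n : ℕ} (hn : n ≠ 0) (s : ℝ) : stepIndex θ n s < n := by
  have : stepIndex θ n s ≤ n - 1 := Nat.count_le _
  omega

theorem lt_stepIndex_iff {θ : ℕ → ℝ} (hθ : Monotone θ) (n : ℕ) (s : ℝ) (i : ℕ) :
    i < stepIndex θ n s ↔ i + 1 < n ∧ θ (i + 1) < s := by
  classical
  rw [stepIndex, lt_count_iff fun a b hab hb => (hθ (by omega)).trans_lt hb]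
  refine and_congr_left fun _ => ?_
  omega

/-- Let `c j k s` have mixed differences that are decreasing in the other coordinates, strictly in
`s`. Then there are potentials `u`, `v` for which the staircase
`s ↦ (stepIndex θ J s, stepIndex η K s)` is, outside the jump times, the unique minimizer of the
reduced cost `c j k s - u j - v k`.

The potentials add up the increments of `c` along the staircase, each taken at its jump time; where
both coordinates jump at the same time, the first is taken to jump first. Away from the staircase
some unit step towards it lowers the reduced cost. -/
theorem exists_potentials {J K : ℕ} {θ η : ℕ → ℝ} (hθ : Monotone θ) (hη : Monotone η)
    (hθ0 : ∀ i, i < J → θ i ≤ 0) (hη0 : ∀ i, i < K → η i ≤ 0) {c : ℕ → ℕ → ℝ → ℝ}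
    (h1 : ∀ j k k' s s', j + 1 < J → k ≤ k' → k' < K → s < s' → s' ≤ 0 →
      c (j + 1) k' s' - c j k' s' < c (j + 1) k s - c j k s)
    (h2 : ∀ k j j' s s', k + 1 < K → j ≤ j' → j' < J → s < s' → s' ≤ 0 →
      c j' (k + 1) s' - c j' k s' < c j (k + 1) s - c j k s) :
    ∃ u v : ℕ → ℝ, ∀ s ≤ 0, (∀ i, i + 1 < J → θ (i + 1) ≠ s) → (∀ i, i + 1 < K → η (i + 1) ≠ s) →
      ∀ j < J, ∀ k < K, ¬ (j = stepIndex θ J s ∧ k = stepIndex η K s) →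
        c (stepIndex θ J s) (stepIndex η K s) s - u (stepIndex θ J s) - v (stepIndex η K s)
          < c j k s - u j - v k := by
  classical
  -- `p i` is the second coordinate at the jump `i` of the first one, and `q h` vice versa; the strict
  -- and the weak inequality in their definitions break ties
  set p : ℕ → ℕ := fun i => stepIndex η K (θ (i + 1)) with hp
  set q : ℕ → ℕ := fun h => Nat.count (fun i => θ (i + 1) ≤ η (h + 1)) (J - 1) with hq
  have hpl : ∀ i h, h < p i ↔ h + 1 < K ∧ η (h + 1) < θ (i + 1) := fun i h =>
    lt_stepIndex_iff hη _ _ _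
  have hql : ∀ h i, i < q h ↔ i + 1 < J ∧ θ (i + 1) ≤ η (h + 1) := fun h i => by
    simp only [hq]
    rw [lt_count_iff fun a b hab hb => (hθ (by omega)).trans hb]
    refine and_congr_left fun _ => ?_
    omega
  have hqJ : ∀ h, q h ≤ J - 1 := fun h => Nat.count_le _
  have hpK : ∀ i, p i ≤ K - 1 := fun h => Nat.count_le _
  refine ⟨fun j => ∑ i ∈ Finset.range j, (c (i + 1) (p i) (θ (i + 1)) - c i (p i) (θ (i + 1))),
    fun k => ∑ h ∈ Finset.range k, (c (q h) (h + 1) (η (h + 1)) - c (q h) h (η (h + 1))), ?_⟩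
  intro s hs hθs hηs
  set a := stepIndex θ J s with ha
  set b := stepIndex η K s with hb
  have hal : ∀ i, i < a ↔ i + 1 < J ∧ θ (i + 1) < s := lt_stepIndex_iff hθ _ _
  have hbl : ∀ i, i < b ↔ i + 1 < K ∧ η (i + 1) < s := lt_stepIndex_iff hη _ _
  set u : ℕ → ℝ := fun j =>
    ∑ i ∈ Finset.range j, (c (i + 1) (p i) (θ (i + 1)) - c i (p i) (θ (i + 1))) with hu
  set v : ℕ → ℝ := fun k =>
    ∑ h ∈ Finset.range k, (c (q h) (h + 1) (η (h + 1)) - c (q h) h (η (h + 1))) with hv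
  have hus : ∀ i, u (i + 1) = u i + (c (i + 1) (p i) (θ (i + 1)) - c i (p i) (θ (i + 1))) :=
    fun i => Finset.sum_range_succ _ _
  have hvs : ∀ i, v (i + 1) = v i + (c (q i) (i + 1) (η (i + 1)) - c (q i) i (η (i + 1))) :=
    fun i => Finset.sum_range_succ _ _
  -- the four kinds of unit steps towards `(a, b)`
  have down1 : ∀ i k, i + 1 < J → k < K → a ≤ i → k ≤ p i →
      c i k s - u i - v k < c (i + 1) k s - u (i + 1) - v k := by
    intro i k hi hk hai hkp
    have h : s < θ (i + 1) := lt_of_le_of_ne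
      (not_lt.1 fun h => absurd ((hal i).2 ⟨hi, h⟩) (by omega)) (hθs i hi).symm
    have := h1 i k (p i) s (θ (i + 1)) hi hkp (by have := hpK i; omega) h (hθ0 _ hi)
    rw [hus]; linarith
  have down2 : ∀ j i, j < J → i + 1 < K → b ≤ i → j ≤ q i →
      c j i s - u j - v i < c j (i + 1) s - u j - v (i + 1) := by
    intro j i hj hi hbi hjq
    have h : s < η (i + 1) := lt_of_le_of_ne
      (not_lt.1 fun h => absurd ((hbl i).2 ⟨hi, h⟩) (by omega)) (hηs i hi).symm
    have := h2 i j (q i) s (η (i + 1)) hi hjq (by have := hqJ i; omega) h (hη0 _ hi)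
    rw [hvs]; linarith
  have up1 : ∀ i k, k < K → i < a → p i ≤ k →
      c (i + 1) k s - u (i + 1) - v k < c i k s - u i - v k := by
    intro i k hk hia hpk
    obtain ⟨hi, h⟩ := (hal i).1 hia
    have := h1 i (p i) k (θ (i + 1)) s hi hpk hk h hs
    rw [hus]; linarith
  have up2 : ∀ j i, j < J → i < b → q i ≤ j →
      c j (i + 1) s - u j - v (i + 1) < c j i s - u j - v i := by
    intro j i hj hib hqj
    obtain ⟨hi, h⟩ := (hbl i).1 hib
    have := h2 i (q i) j (η (i + 1)) s hi hqj hj h hs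
    rw [hvs]; linarith
  have key : ∀ d j k, j < J → k < K → ((j : ℤ) - a).natAbs + ((k : ℤ) - b).natAbs = d →
      ¬ (j = a ∧ k = b) → c a b s - u a - v b < c j k s - u j - v k := by
    intro d
    induction d using Nat.strong_induction_on with
    | _ d ih =>
    intro j k hj hk hd hne
    have step : ∀ j' k', j' < J → k' < K →
        ((j' : ℤ) - a).natAbs + ((k' : ℤ) - b).natAbs < d →
        c j' k' s - u j' - v k' < c j k s - u j - v k →
        c a b s - u a - v b < c j k s - u j - v k := by
      intro j' k' hj' hk' hd' hlt
      by_cases h : j' = a ∧ k' = b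
      · rw [← h.1, ← h.2]; exact hlt
      · exact (ih _ hd' j' k' hj' hk' rfl h).trans hlt
    have d1 : a < j → k ≤ p (j - 1) → c a b s - u a - v b < c j k s - u j - v k := by
      intro haj h
      obtain ⟨i, rfl⟩ : ∃ i, j = i + 1 := ⟨j - 1, by omega⟩
      exact step i k (by omega) hk (by omega) (down1 i k hj hk (by omega) (by simpa using h))
    have d2 : b < k → j ≤ q (k - 1) → c a b s - u a - v b < c j k s - u j - v k := by
      intro hbk h
      obtain ⟨i, rfl⟩ : ∃ i, k = i + 1 := ⟨k - 1, by omega⟩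
      exact step j i hj (by omega) (by omega) (down2 j i hj hk (by omega) (by simpa using h))
    have u1 : j < a → p j ≤ k → c a b s - u a - v b < c j k s - u j - v k := fun hja h =>
      step (j + 1) k ((hal j).1 hja).1 hk (by omega) (up1 j k hk hja h)
    have u2 : k < b → q k ≤ j → c a b s - u a - v b < c j k s - u j - v k := fun hkb h =>
      step j (k + 1) hj ((hbl k).1 hkb).1 (by omega) (up2 j k hj hkb h)
    have later1 : a < j → s < θ j := fun haj => by
      obtain ⟨i, rfl⟩ : ∃ i, j = i + 1 := ⟨j - 1, by omega⟩
      exact lt_of_le_of_ne (not_lt.1 fun h => absurd ((hal i).2 ⟨hj, h⟩) (by omega))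
        (hθs i hj).symm
    have later2 : b < k → s < η k := fun hbk => by
      obtain ⟨i, rfl⟩ : ∃ i, k = i + 1 := ⟨k - 1, by omega⟩
      exact lt_of_le_of_ne (not_lt.1 fun h => absurd ((hbl i).2 ⟨hk, h⟩) (by omega))
        (hηs i hk).symm
    have le_p : a < j → k ≤ b → k ≤ p (j - 1) := fun haj hkb => by
      have h := later1 haj
      refine Nat.le_of_not_lt fun hlt => ?_
      have hx := (hbl (p (j - 1))).1 (by omega)
      have hj' : j - 1 + 1 = j := by omega
      exact lt_irrefl _ ((hpl (j - 1) (p (j - 1))).2 ⟨hx.1, by rw [hj']; exact hx.2.trans h⟩)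
    have le_q : b < k → j ≤ a → j ≤ q (k - 1) := fun hbk hja => by
      have h := later2 hbk
      refine Nat.le_of_not_lt fun hlt => ?_
      have hx := (hal (q (k - 1))).1 (by omega)
      have hk' : k - 1 + 1 = k := by omega
      exact lt_irrefl _ ((hql (k - 1) (q (k - 1))).2
        ⟨hx.1, by rw [hk']; exact (hx.2.trans h).le⟩)
    have p_le : j < a → b ≤ k → p j ≤ k := fun hja hbk => by
      have h := ((hal j).1 hja).2
      refine Nat.le_of_not_lt fun hlt => ?_
      have hx := (hpl j k).1 hlt
      have := (hbl k).2 ⟨hx.1, hx.2.trans h⟩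
      omega
    have q_le : k < b → a ≤ j → q k ≤ j := fun hkb haj => by
      have h := ((hbl k).1 hkb).2
      refine Nat.le_of_not_lt fun hlt => ?_
      have hx := (hql k j).1 hlt
      have := (hal j).2 ⟨hx.1, hx.2.trans_lt h⟩
      omega
    rcases lt_trichotomy j a with hja | hja | hja
    · rcases lt_or_ge k b with hkb | hkb
      · rcases le_or_gt (θ (j + 1)) (η (k + 1)) with h | h
        · exact u1 hja (Nat.le_of_not_lt fun hlt => absurd ((hpl j k).1 hlt).2 (not_lt.2 h))
        · exact u2 hkb (Nat.le_of_not_lt fun hlt => absurd ((hql k j).1 hlt).2 (not_le.2 h))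
      · exact u1 hja (p_le hja hkb)
    · rcases lt_trichotomy k b with hkb | hkb | hkb
      · exact u2 hkb (q_le hkb hja.ge)
      · exact absurd ⟨hja, hkb⟩ hne
      · exact d2 hkb (le_q hkb hja.le)
    · rcases le_or_gt k b with hkb | hkb
      · exact d1 hja (le_p hja hkb)
      · obtain ⟨i, rfl⟩ : ∃ i, j = i + 1 := ⟨j - 1, by omega⟩
        obtain ⟨h, rfl⟩ : ∃ i, k = i + 1 := ⟨k - 1, by omega⟩
        rcases le_or_gt (θ (i + 1)) (η (h + 1)) with hh | hh
        · exact d2 hkb ((hql h i).2 ⟨hj, hh⟩)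
        · exact d1 hja ((hpl i h).2 ⟨hk, hh⟩)
  exact fun j hj k hk hne => key _ j k hj hk rfl hne

section Cost

/-! ### The real commuting disutility -/

theorem _root_.StrictConcaveOn.sub_lt_sub_of_shift {g : ℝ → ℝ} {b : ℝ}
    (hg : StrictConcaveOn ℝ (Iic b) g) {x y d : ℝ} (hxy : x < y) (hd : 0 < d) (hb : y + d ≤ b) :
    g (y + d) - g y < g (x + d) - g x := by
  have hpos : 0 < y + d - x := by linarith
  have hx : x ∈ Iic b := by simp only [mem_Iic]; linarith
  have h1 : 0 < d / (y + d - x) := by positivity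
  have h2 : 0 < (y - x) / (y + d - x) := div_pos (by linarith) hpos
  have h12 : d / (y + d - x) + (y - x) / (y + d - x) = 1 := by field_simp; ring
  have e1 := hg.2 hx (mem_Iic.2 hb) (by linarith) h1 h2 h12
  have e2 := hg.2 hx (mem_Iic.2 hb) (by linarith) h2 h1 (by rw [add_comm]; exact h12)
  simp only [smul_eq_mul] at e1 e2
  rw [show d / (y + d - x) * x + (y - x) / (y + d - x) * (y + d) = y by field_simp; ring] at e1
  rw [show (y - x) / (y + d - x) * x + d / (y + d - x) * (y + d) = x + d by
    field_simp; ring] at e2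
  have e3 : d / (y + d - x) * g x + (y - x) / (y + d - x) * g (y + d)
      + ((y - x) / (y + d - x) * g x + d / (y + d - x) * g (y + d)) = g x + g (y + d) := by
    have : (y - x) / (y + d - x) = 1 - d / (y + d - x) := by linarith
    rw [this]; ring
  linarith

variable {J K : ℕ} (m : CommuteModel J K)

/-- The commuting disutility as a real number; it agrees with `disutility` for `s ≤ 0` only. -/
noncomputable def cost (j : Fin J) (k : Fin K) (s : ℝ) : ℝ :=
  m.α k * m.l j + m.β k * (m.f s).toReal + m.γ k * m.g (s - m.l j)

namespace Assumption

variable {m} [NeZero J] (hm : m.Assumption)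
include hm

theorem l_top_le (j : Fin J) : m.l ⊤ ≤ m.l j := hm.l_anti.antitone le_top

theorem toReal_f_continuousOn : ContinuousOn (fun s => (m.f s).toReal) (Iic 0) :=
  fun s hs => (ENNReal.tendsto_toReal (hm.f_finite s hs)).comp (hm.f_cont s hs)

theorem toReal_f_strictAntiOn : StrictAntiOn (fun s => (m.f s).toReal) (Iic 0) :=
  strictAntiOn_of_deriv_neg (convex_Iic 0) hm.toReal_f_continuousOn fun s hs =>
    hm.f_deriv s (by simpa using hs)

theorem g_strictAntiOn : StrictAntiOn m.g (Iic (-m.l ⊤)) :=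
  strictAntiOn_of_deriv_neg (convex_Iic _) hm.g_cont fun s hs => hm.g_deriv s (by simpa using hs)

theorem g_strictConcaveOn : StrictConcaveOn ℝ (Iic (-m.l ⊤)) m.g :=
  strictConcaveOn_of_deriv2_neg (convex_Iic _) hm.g_cont fun s hs =>
    hm.g_deriv2 s (by simpa using hs)

/-- Where `f` is finite, `g` is only evaluated in the domain on which it is controlled. -/
theorem sub_l_mem {s : ℝ} (hs : s ≤ 0) (j : Fin J) : s - m.l j ∈ Iic (-m.l ⊤) := by
  have := hm.l_top_le j
  simp only [mem_Iic]; linarith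

theorem cost_nonneg (j : Fin J) (k : Fin K) {s : ℝ} (hs : s ≤ 0) : 0 ≤ m.cost j k s := by
  have h1 := mul_nonneg (hm.α_pos k).le (hm.l_nonneg j)
  have h2 := mul_nonneg (hm.β_pos k).le (ENNReal.toReal_nonneg (a := m.f s))
  have h3 := mul_pos (hm.γ_pos k) (hm.g_pos _ (hm.sub_l_mem hs j))
  rw [cost]; linarith

theorem disutility_eq (j : Fin J) (k : Fin K) {s : ℝ} (hs : s ≤ 0) :
    m.disutility j k s = ENNReal.ofReal (m.cost j k s) := by
  have h1 := mul_nonneg (hm.α_pos k).le (hm.l_nonneg j)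
  have h2 := mul_nonneg (hm.β_pos k).le (ENNReal.toReal_nonneg (a := m.f s))
  have h3 := mul_pos (hm.γ_pos k) (hm.g_pos _ (hm.sub_l_mem hs j))
  rw [cost, ENNReal.ofReal_add (add_nonneg h1 h2) h3.le, ENNReal.ofReal_add h1 h2,
    ENNReal.ofReal_mul (hm.β_pos k).le, ENNReal.ofReal_toReal (hm.f_finite s hs), disutility]

theorem disutility_of_pos (j : Fin J) (k : Fin K) {s : ℝ} (hs : 0 < s) :
    m.disutility j k s = ⊤ := by
  simp [disutility, hm.f_late s hs, ENNReal.mul_top, hm.β_pos k]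

theorem cost_strictAntiOn (j : Fin J) (k : Fin K) : StrictAntiOn (m.cost j k) (Iic 0) := by
  intro s hs t ht hst
  have h1 := hm.toReal_f_strictAntiOn hs ht hst
  have h2 := hm.g_strictAntiOn (hm.sub_l_mem hs j) (hm.sub_l_mem ht j) (sub_lt_sub_right hst _)
  have h3 := mul_lt_mul_of_pos_left h1 (hm.β_pos k)
  have h4 := mul_lt_mul_of_pos_left h2 (hm.γ_pos k)
  simp only [cost] at *
  linarith

/-- No measurability of `g` beyond `-l_J` is needed, as the disutility is `⊤` for `s > 0`. -/
theorem measurable_disutility (j : Fin J) (k : Fin K) : Measurable (m.disutility j k) := by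
  have hc : ContinuousOn (m.disutility j k) (Iic 0) := by
    have hcost : ContinuousOn (m.cost j k) (Iic 0) :=
      (continuousOn_const.add (continuousOn_const.mul hm.toReal_f_continuousOn)).add
        (continuousOn_const.mul (hm.g_cont.comp (by fun_prop) fun s hs => hm.sub_l_mem hs j))
    exact (ENNReal.continuous_ofReal.comp_continuousOn hcost).congr fun s hs =>
      hm.disutility_eq j k hs
  have h := hc.measurable_piecewise (g := fun _ => ⊤) continuousOn_const measurableSet_Iic
  convert h using 1
  ext s
  by_cases hs : s ≤ 0
  · simp [piecewise, hs]
  · simp [piecewise, hs, hm.disutility_of_pos j k (not_le.1 hs)]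

/-- The cost of moving one location closer is strictly decreasing in the departure time, because
`g` is strictly concave, and decreasing in the job. -/
theorem cost_sub_lt_of_land {i j : Fin J} (hij : i < j) {k k' : Fin K} (hk : k ≤ k') {s s' : ℝ}
    (hs : s < s') (hs' : s' ≤ 0) :
    m.cost j k' s' - m.cost i k' s' < m.cost j k s - m.cost i k s := by
  have hl := hm.l_anti hij
  have hα := hm.α_mono.monotone hk
  have hγ := hm.γ_mono.monotone hk
  have hpos := hm.γ_pos k
  have hlt := hm.g_strictConcaveOn.sub_lt_sub_of_shift (x := s - m.l i) (y := s' - m.l i)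
    (d := m.l i - m.l j) (by linarith) (by linarith)
    (by have := hm.sub_l_mem hs' j; simp only [mem_Iic] at this; linarith)
  simp only [sub_add_sub_cancel] at hlt
  have hneg := hm.g_strictAntiOn (hm.sub_l_mem hs' i) (hm.sub_l_mem hs' j)
    (sub_lt_sub_left hl s')
  simp only [cost]
  nlinarith [mul_nonneg (sub_nonneg.2 hα) (sub_nonneg.2 hl.le),
    mul_nonneg (sub_nonneg.2 hγ) (sub_nonneg.2 hneg.le), mul_pos hpos (sub_pos.2 hlt)]

theorem cost_sub_lt_of_job {h k : Fin K} (hhk : h < k) {j j' : Fin J} (hj : j ≤ j') {s s' : ℝ}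
    (hs : s < s') (hs' : s' ≤ 0) :
    m.cost j' k s' - m.cost j' h s' < m.cost j k s - m.cost j h s := by
  have hl := hm.l_anti.antitone hj
  have hα := hm.α_mono hhk
  have hβ := hm.β_mono hhk
  have hγ := hm.γ_mono hhk
  have hf := hm.toReal_f_strictAntiOn (hs.le.trans hs') hs' hs
  have hg := hm.g_strictAntiOn (a := s - m.l j) (b := s' - m.l j')
    (hm.sub_l_mem (hs.le.trans hs') j) (hm.sub_l_mem hs' j') (by linarith)
  simp only [cost]
  simp only at hf
  nlinarith [mul_nonneg (sub_nonneg.2 hα.le) (sub_nonneg.2 hl), mul_pos (sub_pos.2 hβ) (sub_pos.2 hf),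
    mul_pos (sub_pos.2 hγ) (sub_pos.2 hg)]

end Assumption

/-! ### The staircase of the Fréchet–Hoeffding distribution -/

/-- The time at which the first `n` classes of the population `q` have left the bottleneck if the
classes leave it in order, at full capacity, from time `-T` on. -/
noncomputable def breakTime {N : ℕ} (q : Fin N → ℝ≥0) (n : ℕ) : ℝ :=
  (∑ i with i.val < n, (q i : ℝ)) / m.μ - m.T

theorem breakTime_mono {N : ℕ} (q : Fin N → ℝ≥0) : Monotone (m.breakTime q) := by
  intro a b hab
  refine sub_le_sub_right (div_le_div_of_nonneg_right ?_ m.μ.2) _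
  refine Finset.sum_le_sum_of_subset_of_nonneg (fun i hi => ?_) fun _ _ _ => NNReal.coe_nonneg _
  simp only [Finset.mem_filter, Finset.mem_univ, true_and] at hi ⊢
  omega

theorem breakTime_zero {N : ℕ} (q : Fin N → ℝ≥0) : m.breakTime q 0 = -m.T := by
  simp [breakTime]

theorem breakTime_self {N : ℕ} {q : Fin N → ℝ≥0} (hq : ∑ i, q i = ∑ k, m.Q k) :
    m.breakTime q N = 0 := by
  have : ∑ i, (q i : ℝ) = ∑ k, (m.Q k : ℝ) := by exact_mod_cast hq
  simp [breakTime, this, T]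

theorem breakTime_nonpos {N : ℕ} {q : Fin N → ℝ≥0} (hq : ∑ i, q i = ∑ k, m.Q k) {n : ℕ}
    (hn : n ≤ N) : m.breakTime q n ≤ 0 :=
  (m.breakTime_mono q hn).trans_eq (m.breakTime_self hq)

/-- The class of the population `q` that leaves the bottleneck at time `s` if the classes leave it
in order. -/
noncomputable def classAt {N : ℕ} [NeZero N] (q : Fin N → ℝ≥0) (s : ℝ) : Fin N :=
  ⟨stepIndex (m.breakTime q) N s, stepIndex_lt _ (NeZero.ne N) s⟩

theorem classAt_lt_iff {N : ℕ} [NeZero N] {q : Fin N → ℝ≥0} (hq : ∑ i, q i = ∑ k, m.Q k) {s : ℝ}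
    (hs : s ∈ Ioc (-m.T) 0) {n : ℕ} (hn : n ≤ N) :
    (m.classAt q s : ℕ) < n ↔ s ≤ m.breakTime q n := by
  rcases Nat.eq_zero_or_pos n with rfl | hpos
  · simpa [breakTime_zero] using hs.1
  obtain ⟨i, rfl⟩ : ∃ i, n = i + 1 := ⟨n - 1, by omega⟩
  have h := lt_stepIndex_iff (m.breakTime_mono q) N s i
  rw [← not_lt (b := s), ← not_le, Nat.succ_le_iff, classAt, h]
  rcases hn.lt_or_eq with hlt | heq
  · simp [hlt]
  · have h0 := (congrArg (m.breakTime q) heq).trans (m.breakTime_self hq)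
    simp [h0, hs.2, heq.not_lt]

theorem measurable_classAt {N : ℕ} [NeZero N] (q : Fin N → ℝ≥0) : Measurable (m.classAt q) := by
  have hmono : Monotone (stepIndex (m.breakTime q) N) := fun s t hst =>
    Nat.le_of_not_lt fun hlt => by
      have h := (lt_stepIndex_iff (m.breakTime_mono q) N s _).1 hlt
      exact lt_irrefl _ ((lt_stepIndex_iff (m.breakTime_mono q) N t _).2 ⟨h.1, h.2.trans_le hst⟩)
  refine measurable_to_countable' fun j => ?_
  convert hmono.measurable (measurableSet_singleton (j : ℕ)) using 1
  ext s
  simp [classAt, Fin.ext_iff]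

/-! ### Dual solution -/

section Dual

variable {m} [NeZero J] [NeZero K]

theorem Assumption.exists_potentials (hm : m.Assumption) (hbal : ∑ j, m.R j = ∑ k, m.Q k) :
    ∃ (u : Fin J → ℝ) (v : Fin K → ℝ), ∀ s ≤ 0, (∀ i, i < J → m.breakTime m.R i ≠ s) →
      (∀ i, i < K → m.breakTime m.Q i ≠ s) → ∀ j k, ¬ (j = m.classAt m.R s ∧ k = m.classAt m.Q s) →
        m.cost (m.classAt m.R s) (m.classAt m.Q s) s - u (m.classAt m.R s) - v (m.classAt m.Q s)
          < m.cost j k s - u j - v k := by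
  obtain ⟨u, v, h⟩ := CommuteModel.exists_potentials (J := J) (K := K)
    (m.breakTime_mono m.R) (m.breakTime_mono m.Q)
    (fun i hi => m.breakTime_nonpos hbal hi.le) (fun i hi => m.breakTime_nonpos rfl hi.le)
    (c := fun j k s => m.cost (Fin.ofNat J j) (Fin.ofNat K k) s)
    (fun j k k' s s' hj hk hk' hs hs' => hm.cost_sub_lt_of_land
      (by simp [Fin.lt_def, Nat.mod_eq_of_lt hj, Nat.mod_eq_of_lt (show j < J by omega)])
      (by simpa [Fin.le_def, Nat.mod_eq_of_lt hk', Nat.mod_eq_of_lt (hk.trans_lt hk')] using hk)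
      hs hs')
    (fun k j j' s s' hk hj hj' hs hs' => hm.cost_sub_lt_of_job
      (by simp [Fin.lt_def, Nat.mod_eq_of_lt hk, Nat.mod_eq_of_lt (show k < K by omega)])
      (by simpa [Fin.le_def, Nat.mod_eq_of_lt hj', Nat.mod_eq_of_lt (hj.trans_lt hj')] using hj)
      hs hs')
  refine ⟨fun j => u j, fun k => v k, fun s hs hR hQ j k hne => ?_⟩
  have := h s hs (fun i hi => hR _ hi) (fun i hi => hQ _ hi) j j.2 k k.2
    (by simpa [Fin.ext_iff, classAt] using hne)
  have e1 : Fin.ofNat J (stepIndex (m.breakTime m.R) J s) = m.classAt m.R s :=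
    Fin.ofNat_val_eq_self (m.classAt m.R s)
  have e2 : Fin.ofNat K (stepIndex (m.breakTime m.Q) K s) = m.classAt m.Q s :=
    Fin.ofNat_val_eq_self (m.classAt m.Q s)
  simp only [e1, e2, Fin.ofNat_val_eq_self] at this
  exact this

/-- An optimal dual solution: `U` and `V` are the prices of locations and jobs, shifted to be
nonnegative, `p` is the price of the bottleneck capacity, and `M` absorbs the shift. Complementary
slackness holds strictly. -/
theorem Assumption.exists_dual (hm : m.Assumption) (hbal : ∑ j, m.R j = ∑ k, m.Q k) :
    ∃ (U : Fin J → ℝ≥0) (V : Fin K → ℝ≥0) (M : ℝ≥0) (p : ℝ → ℝ≥0∞), Measurable p ∧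
      (∀ j k s, (U j + V k : ℝ≥0∞) ≤ M + m.disutility j k s + p s) ∧
      (∀ s ∉ Icc (-m.T) 0, p s = 0 ∧ ∀ j k, (U j + V k : ℝ≥0∞) < M + m.disutility j k s) ∧
      ∀ s ∈ Icc (-m.T) 0, (∀ i, i < J → m.breakTime m.R i ≠ s) →
        (∀ i, i < K → m.breakTime m.Q i ≠ s) → ∀ j k,
          (j = m.classAt m.R s ∧ k = m.classAt m.Q s →
            (U j + V k : ℝ≥0∞) = M + m.disutility j k s + p s) ∧
          (¬ (j = m.classAt m.R s ∧ k = m.classAt m.Q s) →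
            (U j + V k : ℝ≥0∞) < M + m.disutility j k s + p s) := by
  obtain ⟨u, v, h⟩ := hm.exists_potentials hbal
  have hT : -m.T ≤ 0 := by
    simp only [T, Left.neg_nonpos_iff]
    positivity
  have hc0 := hm.cost_nonneg 0 0 hT
  -- the shifts `a` and `b` make the prices nonnegative, and also the maximum `M` below
  set a : ℝ := ∑ j, |u j| + m.cost 0 0 (-m.T) with ha
  set b : ℝ := ∑ k, |v k| with hb
  have hua : ∀ j, m.cost 0 0 (-m.T) ≤ u j + a := fun j => by
    have h1 := Finset.single_le_sum (f := fun j => |u j|) (fun i _ => abs_nonneg _)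
      (Finset.mem_univ j)
    have h2 := neg_abs_le (u j)
    linarith
  have hvb : ∀ k, 0 ≤ v k + b := fun k => by
    have h1 := Finset.single_le_sum (f := fun j => |v j|) (fun i _ => abs_nonneg _)
      (Finset.mem_univ k)
    have h2 := neg_abs_le (v k)
    linarith
  obtain ⟨⟨j1, k1⟩, -, hmax⟩ := Finset.exists_max_image (Finset.univ : Finset (Fin J × Fin K))
    (fun q => (u q.1 + a) + (v q.2 + b) - m.cost q.1 q.2 (-m.T)) ⟨(0, 0), Finset.mem_univ _⟩
  simp only [Finset.mem_univ, forall_const, Prod.forall] at hmax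
  set M : ℝ := (u j1 + a) + (v k1 + b) - m.cost j1 k1 (-m.T) with hM
  have hM0 : 0 ≤ M := by
    have := hmax 0 0
    have := hua 0
    have := hvb 0
    linarith
  have hUV : ∀ j k, ((u j + a).toNNReal + (v k + b).toNNReal : ℝ≥0∞)
      = ENNReal.ofReal ((u j + a) + (v k + b)) := fun j k => by
    rw [ENNReal.ofReal_add (hc0.trans (hua j)) (hvb k)]; rfl
  have hMc : ∀ j k, ∀ s ≤ 0, (M.toNNReal + m.disutility j k s : ℝ≥0∞)
      = ENNReal.ofReal (M + m.cost j k s) := fun j k s hs => by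
    rw [ENNReal.ofReal_add hM0 (hm.cost_nonneg j k hs), hm.disutility_eq j k hs]; rfl
  have hout : ∀ s ∉ Icc (-m.T) 0, ∀ j k, ((u j + a).toNNReal + (v k + b).toNNReal : ℝ≥0∞)
      < M.toNNReal + m.disutility j k s := by
    intro s hs j k
    rcases lt_or_ge 0 s with h0 | h0
    · rw [hm.disutility_of_pos j k h0, hUV]
      simp
    · have hsT : s < -m.T := not_le.1 fun h => hs ⟨h, h0⟩
      have h1 := hm.cost_strictAntiOn j k h0 hT hsT
      have h2 := hmax j k
      have h3 := hm.cost_nonneg j k h0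
      rw [hUV, hMc j k s h0]
      exact (ENNReal.ofReal_lt_ofReal_iff_of_nonneg
        (by have := hua j; have := hvb k; linarith)).2 (by linarith)
  refine ⟨fun j => (u j + a).toNNReal, fun k => (v k + b).toNNReal, M.toNNReal,
    fun s => ⨆ j, ⨆ k, (((u j + a).toNNReal + (v k + b).toNNReal : ℝ≥0∞)
      - (M.toNNReal + m.disutility j k s)), ?_, ?_, ?_, ?_⟩
  · exact .iSup fun j => .iSup fun k =>
      measurable_const.sub (measurable_const.add (hm.measurable_disutility j k))
  · intro j k s
    rw [← tsub_le_iff_left]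
    exact le_iSup₂_of_le j k le_rfl
  · intro s hs
    refine ⟨?_, hout s hs⟩
    simp only [ENNReal.iSup_eq_zero, tsub_eq_zero_iff_le]
    exact fun j k => (hout s hs j k).le
  · intro s hs hR hQ j k
    set x := m.classAt m.R s with hx
    set y := m.classAt m.Q s with hy
    have hmin : ∀ j k, m.cost x y s - u x - v y ≤ m.cost j k s - u j - v k := fun j k => by
      by_cases hjk : j = x ∧ k = y
      · rw [hjk.1, hjk.2]
      · exact (h s hs.2 hR hQ j k hjk).le
    -- the pair attaining `M` shows that the minimal reduced cost has not risen since `-T`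
    have hneg : M + m.cost x y s ≤ (u x + a) + (v y + b) := by
      have h1 := hmin j1 k1
      have h2 := (hm.cost_strictAntiOn j1 k1).antitoneOn hT hs.2 hs.1
      linarith
    have hp : (⨆ j, ⨆ k, (((u j + a).toNNReal + (v k + b).toNNReal : ℝ≥0∞)
        - (M.toNNReal + m.disutility j k s)))
        = ENNReal.ofReal ((u x + a) + (v y + b) - (M + m.cost x y s)) := by
      have hsub : ∀ j k, ((u j + a).toNNReal + (v k + b).toNNReal : ℝ≥0∞)
          - (M.toNNReal + m.disutility j k s)
          = ENNReal.ofReal ((u j + a) + (v k + b) - (M + m.cost j k s)) := fun j k => by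
        rw [hUV, hMc j k s hs.2, ENNReal.ofReal_sub _
          (add_nonneg hM0 (hm.cost_nonneg j k hs.2))]
      refine le_antisymm (iSup₂_le fun j k => ?_) (le_iSup₂_of_le x y (hsub x y).ge)
      rw [hsub]
      exact ENNReal.ofReal_le_ofReal (by linarith [hmin j k])
    dsimp only
    rw [hp, hUV, hMc j k s hs.2, ← ENNReal.ofReal_add
      (add_nonneg hM0 (hm.cost_nonneg j k hs.2)) (by linarith)]
    constructor
    · rintro ⟨rfl, rfl⟩
      congr 1; ring
    · intro hjk
      have h1 := h s hs.2 hR hQ j k hjk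
      exact (ENNReal.ofReal_lt_ofReal_iff_of_nonneg
        (by have := hua j; have := hvb k; linarith)).2 (by linarith)

end Dual

end Cost

section Flow

theorem _root_.ENNReal.eq_of_le_of_sum_le {ι : Type*} {t : Finset ι} {f g : ι → ℝ≥0∞}
    (hle : ∀ i ∈ t, f i ≤ g i) (hsum : ∑ i ∈ t, g i ≤ ∑ i ∈ t, f i) (hfin : ∑ i ∈ t, f i ≠ ⊤)
    {i : ι} (hi : i ∈ t) : f i = g i := by
  classical
  refine (hle i hi).antisymm ?_
  have hfin' : ∑ x ∈ t.erase i, f x ≠ ⊤ :=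
    ne_top_of_le_ne_top hfin (Finset.sum_le_sum_of_subset (Finset.erase_subset _ _))
  rw [← Finset.add_sum_erase _ _ hi, ← Finset.add_sum_erase _ _ hi] at hsum
  exact (ENNReal.add_le_add_iff_right hfin').1 ((add_le_add_right (Finset.sum_le_sum fun x hx =>
    hle x (Finset.mem_of_mem_erase hx)) _).trans hsum)

variable {J K : ℕ} (m : CommuteModel J K)

/-! ### Flow measures and their optimality -/

/-- A family of measures on the time axis, `ν j k` counting the departures of the users `(j, k)`,
that respects the capacity of the bottleneck and has the prescribed totals. Both the linear program
and the transport problem reduce to such families. -/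
structure IsFlow (ν : Fin J → Fin K → Measure ℝ) : Prop where
  capacity : ∑ j, ∑ k, ν j k ≤ m.μ • volume
  land : ∀ j, ∑ k, ν j k univ = m.R j
  job : ∀ k, ∑ j, ν j k univ = m.Q k

/-- The total disutility of a family of flow measures. -/
noncomputable def flowCost (ν : Fin J → Fin K → Measure ℝ) : ℝ≥0∞ :=
  ∑ j, ∑ k, ∫⁻ s, m.disutility j k s ∂ν j k

theorem T_nonneg : 0 ≤ m.T := by
  rw [T]; positivity

theorem mul_T {m : CommuteModel J K} (hμ : 0 < m.μ) : (m.μ : ℝ) * m.T = ∑ k, (m.Q k : ℝ) := by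
  have : (m.μ : ℝ) ≠ 0 := by exact_mod_cast hμ.ne'
  rw [T]; field_simp

theorem smul_volume_Ioc (a b : ℝ) :
    (m.μ • volume : Measure ℝ) (Ioc a b) = ENNReal.ofReal (m.μ * (b - a)) := by
  rw [Measure.smul_apply, Real.volume_Ioc, ENNReal.ofReal_mul (NNReal.coe_nonneg _),
    ENNReal.ofReal_coe_nnreal, ENNReal.smul_def, smul_eq_mul]

variable [NeZero J] [NeZero K]

/-- The departure times of the users `(j, k)` if both the locations and the jobs leave the
bottleneck in order. -/
def stairSet (j : Fin J) (k : Fin K) : Set ℝ :=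
  {s | s ∈ Ioc (-m.T) 0 ∧ m.classAt m.R s = j ∧ m.classAt m.Q s = k}

/-- The comonotone flow: at full capacity, on `stairSet`. -/
noncomputable def stairFlow (j : Fin J) (k : Fin K) : Measure ℝ :=
  (m.μ • volume).restrict (m.stairSet j k)

theorem measurableSet_stairSet (j : Fin J) (k : Fin K) : MeasurableSet (m.stairSet j k) :=
  measurableSet_Ioc.inter (((m.measurable_classAt m.R) (measurableSet_singleton j)).inter
    ((m.measurable_classAt m.Q) (measurableSet_singleton k)))

theorem disjoint_stairSet {j j' : Fin J} {k k' : Fin K} (h : ¬ (j = j' ∧ k = k')) :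
    Disjoint (m.stairSet j k) (m.stairSet j' k') := by
  rw [Set.disjoint_left]
  rintro s ⟨-, h1, h2⟩ ⟨-, h3, h4⟩
  exact h ⟨h1.symm.trans h3, h2.symm.trans h4⟩

theorem sum_stairFlow_apply (a : Finset (Fin J)) (b : Finset (Fin K)) {A : Set ℝ}
    (hA : MeasurableSet A) :
    ∑ j ∈ a, ∑ k ∈ b, m.stairFlow j k A = (m.μ • volume : Measure ℝ)
      {s | s ∈ A ∧ s ∈ Ioc (-m.T) 0 ∧ m.classAt m.R s ∈ a ∧ m.classAt m.Q s ∈ b} := by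
  rw [← Finset.sum_product']
  simp only [stairFlow, Measure.restrict_apply hA]
  rw [← measure_biUnion_finset (f := fun q : Fin J × Fin K => A ∩ m.stairSet q.1 q.2)]
  · congr 1
    ext s
    simp only [stairSet, mem_iUnion, mem_inter_iff, mem_ofPred_eq, Finset.mem_product, Prod.exists,
      exists_prop]
    constructor
    · rintro ⟨j, k, ⟨hj, hk⟩, hs, hI, rfl, rfl⟩
      exact ⟨hs, hI, hj, hk⟩
    · rintro ⟨hs, hI, hj, hk⟩
      exact ⟨_, _, ⟨hj, hk⟩, hs, hI, rfl, rfl⟩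
  · rintro ⟨j, k⟩ - ⟨j', k'⟩ - hne
    exact (m.disjoint_stairSet (by simpa [Prod.ext_iff] using hne)).mono inter_subset_right
      inter_subset_right
  · exact fun q _ => hA.inter (m.measurableSet_stairSet _ _)

theorem sum_stairFlow :
    ∑ j, ∑ k, m.stairFlow j k = (m.μ • volume : Measure ℝ).restrict (Ioc (-m.T) 0) := by
  ext A hA
  simp only [Measure.finsetSum_apply]
  rw [m.sum_stairFlow_apply _ _ hA, Measure.restrict_apply hA]
  congr 1
  ext s
  simp only [mem_ofPred_eq, mem_inter_iff, Finset.mem_univ, and_true]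

omit [NeZero J] [NeZero K] in
theorem volume_classAt_eq {N : ℕ} [NeZero N] {q : Fin N → ℝ≥0} (hμ : 0 < m.μ)
    (hq : ∑ i, q i = ∑ k, m.Q k) (i : Fin N) :
    (m.μ • volume : Measure ℝ) {s | s ∈ Ioc (-m.T) 0 ∧ m.classAt q s = i} = q i := by
  have hset : {s | s ∈ Ioc (-m.T) 0 ∧ m.classAt q s = i}
      = Ioc (m.breakTime q i) (m.breakTime q (i + 1)) := by
    ext s
    have hmono := m.breakTime_mono q
    constructor
    · rintro ⟨hs, h⟩
      have h1 := m.classAt_lt_iff hq hs (n := i) i.2.le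
      have h2 := m.classAt_lt_iff hq hs (n := i + 1) i.2
      rw [h] at h1 h2
      exact ⟨not_le.1 fun hle => lt_irrefl _ (h1.2 hle), h2.1 (Nat.lt_succ_self _)⟩
    · rintro ⟨ha, hb⟩
      have hs : s ∈ Ioc (-m.T) 0 :=
        ⟨(m.breakTime_zero q ▸ hmono (Nat.zero_le i)).trans_lt ha,
          hb.trans (m.breakTime_nonpos hq i.2)⟩
      have h1 := m.classAt_lt_iff hq hs (n := i) i.2.le
      have h2 := m.classAt_lt_iff hq hs (n := i + 1) i.2
      refine ⟨hs, Fin.ext ?_⟩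
      have h3 := h2.2 hb
      have h4 : ¬ (m.classAt q s : ℕ) < i := fun h => not_lt.2 (h1.1 h) ha
      omega
  have hμ' : (m.μ : ℝ) ≠ 0 := by exact_mod_cast hμ.ne'
  have hsum : ∑ x with x.val < i.val + 1, (q x : ℝ) = (∑ x with x.val < i.val, (q x : ℝ)) + q i := by
    have : (Finset.univ.filter fun x : Fin N => x.val < i.val + 1)
        = insert i (Finset.univ.filter fun x : Fin N => x.val < i.val) := by
      ext x
      simp only [Finset.mem_filter, Finset.mem_univ, true_and, Finset.mem_insert, Fin.ext_iff]
      omega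
    rw [this, Finset.sum_insert (by simp), add_comm]
  rw [hset, smul_volume_Ioc, breakTime, breakTime, hsum]
  rw [show (m.μ : ℝ) * (((∑ x with x.val < i.val, (q x : ℝ)) + q i) / m.μ - m.T
    - ((∑ x with x.val < i.val, (q x : ℝ)) / m.μ - m.T)) = q i by field_simp; ring]
  exact ENNReal.ofReal_coe_nnreal

theorem isFlow_stairFlow (hμ : 0 < m.μ) (hbal : ∑ j, m.R j = ∑ k, m.Q k) :
    m.IsFlow m.stairFlow where
  capacity := m.sum_stairFlow.trans_le Measure.restrict_le_self
  land j := by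
    have := m.sum_stairFlow_apply {j} Finset.univ MeasurableSet.univ
    simp only [Finset.sum_singleton, Finset.mem_singleton, Finset.mem_univ, mem_univ, true_and,
      and_true] at this
    rw [this, m.volume_classAt_eq hμ hbal]
  job k := by
    have := m.sum_stairFlow_apply Finset.univ {k} MeasurableSet.univ
    simp only [Finset.sum_singleton, Finset.mem_singleton, Finset.mem_univ, mem_univ, true_and] at this
    rw [this, m.volume_classAt_eq hμ rfl]

/-- The sum of the flow up to time `s` over the first locations and jobs is the minimum of the
three marginal distribution functions. -/
theorem sum_stairFlow_Iic (hμ : 0 < m.μ) (hbal : ∑ j, m.R j = ∑ k, m.Q k) {ζ κ s : ℝ}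
    (hζ : ζ ∈ Icc (1 : ℝ) J) (hκ : κ ∈ Icc (1 : ℝ) K) (hs : s ≤ 0) :
    ∑ j ∈ upTo J ζ, ∑ k ∈ upTo K κ, m.stairFlow j k (Iic s)
      = ENNReal.ofReal (m.frechetHoeffding ζ κ s) := by
  have hup : ∀ {N : ℕ} [NeZero N] (x : ℝ), x ∈ Icc (1 : ℝ) N → ⌊x⌋₊ ≤ N ∧
      ∀ i : Fin N, i ∈ upTo N x ↔ i.val < ⌊x⌋₊ := by
    intro N _ x hx
    refine ⟨Nat.floor_le_of_le hx.2, fun i => ?_⟩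
    rw [upTo, Finset.mem_filter, ← Nat.succ_le_iff, Nat.le_floor_iff (by linarith [hx.1])]
    simp
  obtain ⟨h1, h2⟩ := hup ζ hζ
  obtain ⟨h3, h4⟩ := hup κ hκ
  have hset : {t | t ∈ Iic s ∧ t ∈ Ioc (-m.T) 0 ∧ m.classAt m.R t ∈ upTo J ζ ∧
      m.classAt m.Q t ∈ upTo K κ}
      = Ioc (-m.T) (min (m.breakTime m.R ⌊ζ⌋₊) (min (m.breakTime m.Q ⌊κ⌋₊) s)) := by
    ext t
    simp only [mem_ofPred_eq, h2, h4, mem_Iic]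
    constructor
    · rintro ⟨ht, htI, ha, hb⟩
      exact ⟨htI.1, le_min ((m.classAt_lt_iff hbal htI h1).1 ha)
        (le_min ((m.classAt_lt_iff rfl htI h3).1 hb) ht)⟩
    · rintro ⟨hT, ht⟩
      obtain ⟨ha, hb, ht⟩ : t ≤ _ ∧ t ≤ _ ∧ t ≤ s := by simpa using ht
      have htI : t ∈ Ioc (-m.T) 0 := ⟨hT, ht.trans hs⟩
      exact ⟨ht, htI, (m.classAt_lt_iff hbal htI h1).2 ha, (m.classAt_lt_iff rfl htI h3).2 hb⟩
  have hμ' : (0 : ℝ) < m.μ := by exact_mod_cast hμ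
  have hbreak : ∀ {N : ℕ} (q : Fin N → ℝ≥0) (x : ℝ), (∀ i : Fin N, i ∈ upTo N x ↔ i.val < ⌊x⌋₊) →
      (m.μ : ℝ) * (m.breakTime q ⌊x⌋₊ + m.T) = ∑ i ∈ upTo N x, (q i : ℝ) := by
    intro N q x hx
    have : (Finset.univ.filter fun i : Fin N => i.val < ⌊x⌋₊) = upTo N x := by
      ext i; simp [hx]
    rw [breakTime, this]
    field_simp; ring
  rw [m.sum_stairFlow_apply _ _ measurableSet_Iic, hset, smul_volume_Ioc, sub_neg_eq_add,
    frechetHoeffding, ← hbreak m.R ζ h2, ← hbreak m.Q κ h4, add_comm m.T s,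
    ← mul_min_of_nonneg _ _ hμ'.le, ← mul_min_of_nonneg _ _ hμ'.le, min_add_add_right,
    min_add_add_right]

/-- A family that is concentrated on the staircase is determined by its sum. -/
theorem eq_restrict_of_ae_mem_stairSet {ν : Fin J → Fin K → Measure ℝ}
    (h : ∀ j k, ∀ᵐ s ∂ν j k, s ∈ m.stairSet j k) (j : Fin J) (k : Fin K) :
    ν j k = (∑ j, ∑ k, ν j k).restrict (m.stairSet j k) := by
  have hres : ∀ j' k', (ν j' k').restrict (m.stairSet j k)
      = if j' = j ∧ k' = k then ν j k else 0 := by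
    intro j' k'
    split_ifs with hjk
    · rw [hjk.1, hjk.2, Measure.restrict_eq_self_of_ae_mem (h j k)]
    · rw [Measure.restrict_eq_zero]
      refine measure_mono_null (t := {s | s ∉ m.stairSet j' k'}) (fun s hs hs' => ?_) (h j' k')
      exact Set.disjoint_left.1 (m.disjoint_stairSet hjk) hs' hs
  ext A hA
  rw [Measure.restrict_apply hA]
  simp only [Measure.finsetSum_apply]
  simp only [← Measure.restrict_apply hA, hres]
  rw [Finset.sum_eq_single j, Finset.sum_eq_single k] <;> simp +contextual

/-- The comonotone flow is the unique flow of minimal cost. -/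
theorem flowCost_stairFlow (hμ : 0 < m.μ) (hbal : ∑ j, m.R j = ∑ k, m.Q k) (hm : m.Assumption)
    {ν : Fin J → Fin K → Measure ℝ} (hν : m.IsFlow ν) :
    m.flowCost m.stairFlow ≠ ⊤ ∧ m.flowCost m.stairFlow ≤ m.flowCost ν ∧
      (m.flowCost ν ≤ m.flowCost m.stairFlow → ν = m.stairFlow) := by
  obtain ⟨U, V, M, p, hp, hle, hout, hin⟩ := hm.exists_dual hbal
  set N₀ : Measure ℝ := ∑ j, ∑ k, m.stairFlow j k with hN₀
  have hst := m.isFlow_stairFlow hμ hbal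
  have hpoint : ∀ {ν : Fin J → Fin K → Measure ℝ}, m.IsFlow ν → ∀ j k, ν j k ≤ m.μ • volume := by
    intro ν hν j k
    refine le_trans ?_ hν.capacity
    intro A
    simp only [Measure.finsetSum_apply]
    exact (Finset.single_le_sum (f := fun k => ν j k A) (fun _ _ => zero_le) (Finset.mem_univ k)).trans
      (Finset.single_le_sum (f := fun j => ∑ k, ν j k A) (fun _ _ => zero_le) (Finset.mem_univ j))
  -- outside the finitely many jump times the slackness of the dual solution is strict
  have hae : ∀ᵐ s ∂(m.μ • volume : Measure ℝ), ∀ j k,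
      (s ∈ m.stairSet j k → (U j + V k : ℝ≥0∞) = M + m.disutility j k s + p s) ∧
      (s ∉ m.stairSet j k → (U j + V k : ℝ≥0∞) < M + m.disutility j k s + p s) := by
    refine Measure.ae_smul_measure ?_ _
    have h1 : ∀ᵐ s : ℝ, ∀ i, m.breakTime m.R i ≠ s :=
      ae_all_iff.2 fun i => (Measure.ae_ne volume (m.breakTime m.R i)).mono fun s hs => hs.symm
    have h2 : ∀ᵐ s : ℝ, ∀ i, m.breakTime m.Q i ≠ s :=
      ae_all_iff.2 fun i => (Measure.ae_ne volume (m.breakTime m.Q i)).mono fun s hs => hs.symm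
    filter_upwards [h1, h2] with s h1 h2 j k
    by_cases hs : s ∈ Icc (-m.T) 0
    · have hs' : s ∈ Ioc (-m.T) 0 :=
        ⟨lt_of_le_of_ne hs.1 (by simpa [breakTime_zero] using h1 0), hs.2⟩
      have h := hin s hs (fun i _ => h1 i) (fun i _ => h2 i) j k
      refine ⟨fun hmem => h.1 ⟨hmem.2.1.symm, hmem.2.2.symm⟩, fun hmem => h.2 ?_⟩
      rintro ⟨hj, hk⟩
      exact hmem ⟨hs', hj.symm, hk.symm⟩
    · refine ⟨fun hmem => absurd ⟨hmem.1.1.le, hmem.1.2⟩ hs, fun _ => ?_⟩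
      rw [(hout s hs).1, add_zero]
      exact (hout s hs).2 j k
  have haeν : ∀ {ν : Fin J → Fin K → Measure ℝ}, m.IsFlow ν → ∀ j k, ∀ᵐ s ∂ν j k,
      (s ∈ m.stairSet j k → (U j + V k : ℝ≥0∞) = M + m.disutility j k s + p s) ∧
      (s ∉ m.stairSet j k → (U j + V k : ℝ≥0∞) < M + m.disutility j k s + p s) :=
    fun hν j k => (Measure.absolutelyContinuous_of_le (hpoint hν j k)).ae_le
      (hae.mono fun s h => h j k)
  set D : ℝ≥0∞ := ∑ j, (U j : ℝ≥0∞) * m.R j + ∑ k, (V k : ℝ≥0∞) * m.Q k with hD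
  have hDtop : D ≠ ⊤ := by
    simp [hD, ENNReal.sum_eq_top, ENNReal.mul_eq_top]
  have hdual : ∀ {ν : Fin J → Fin K → Measure ℝ}, m.IsFlow ν →
      ∑ j, ∑ k, ∫⁻ _, (U j + V k : ℝ≥0∞) ∂ν j k = D := by
    intro ν hν
    simp only [lintegral_const, add_mul, Finset.sum_add_distrib]
    rw [hD]
    congr 1
    · exact Finset.sum_congr rfl fun j _ => by rw [← Finset.mul_sum, hν.land]
    · rw [Finset.sum_comm]
      exact Finset.sum_congr rfl fun k _ => by rw [← Finset.mul_sum, hν.job]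
  set W : ℝ≥0∞ := M * ∑ j, (m.R j : ℝ≥0∞) with hW
  have hsplit : ∀ {ν : Fin J → Fin K → Measure ℝ}, m.IsFlow ν →
      ∑ j, ∑ k, ∫⁻ s, (M + m.disutility j k s + p s) ∂ν j k
        = W + m.flowCost ν + ∫⁻ s, p s ∂(∑ j, ∑ k, ν j k) := by
    intro ν hν
    have : ∀ j k, ∫⁻ s, (M + m.disutility j k s + p s) ∂ν j k
        = M * ν j k univ + ∫⁻ s, m.disutility j k s ∂ν j k + ∫⁻ s, p s ∂ν j k := fun j k => by
      rw [lintegral_add_right _ hp, lintegral_add_left measurable_const, lintegral_const]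
    simp only [this, Finset.sum_add_distrib, lintegral_finsetSum_measure, ← Finset.mul_sum,
      hν.land]
    rfl
  -- the price of the capacity vanishes off the rush period, during which the comonotone flow
  -- uses the full capacity
  have hcap : ∀ {ν : Fin J → Fin K → Measure ℝ}, m.IsFlow ν →
      ∫⁻ s, p s ∂(∑ j, ∑ k, ν j k) ≤ ∫⁻ s, p s ∂N₀ := by
    intro ν hν
    have hind : (Icc (-m.T) 0).indicator p = p :=
      indicator_eq_self.2 fun s hs => by_contra fun h => hs (hout s h).1
    calc ∫⁻ s, p s ∂(∑ j, ∑ k, ν j k) ≤ ∫⁻ s, p s ∂(m.μ • volume : Measure ℝ) :=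
          lintegral_mono' hν.capacity le_rfl
      _ = ∫⁻ s in Icc (-m.T) 0, p s ∂(m.μ • volume : Measure ℝ) := by
          rw [← lintegral_indicator measurableSet_Icc, hind]
      _ = ∫⁻ s, p s ∂N₀ := by
          rw [hN₀, sum_stairFlow, Measure.restrict_smul, Measure.restrict_smul,
            restrict_Ioc_eq_restrict_Icc]
  have hopt : W + m.flowCost m.stairFlow + ∫⁻ s, p s ∂N₀ = D := by
    rw [← hsplit hst, ← hdual hst]
    refine Finset.sum_congr rfl fun j _ => Finset.sum_congr rfl fun k _ => lintegral_congr_ae ?_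
    filter_upwards [haeν hst j k, ae_restrict_mem (m.measurableSet_stairSet j k)] with s hs hmem
    exact (hs.1 hmem).symm
  have hfin : W + m.flowCost m.stairFlow + ∫⁻ s, p s ∂N₀ ≠ ⊤ := hopt ▸ hDtop
  simp only [ne_eq, ENNReal.add_eq_top, not_or] at hfin
  have hlow : D ≤ W + m.flowCost ν + ∫⁻ s, p s ∂(∑ j, ∑ k, ν j k) := by
    rw [← hsplit hν, ← hdual hν]
    exact Finset.sum_le_sum fun j _ => Finset.sum_le_sum fun k _ => lintegral_mono (hle j k)
  refine ⟨hfin.1.2, ?_, fun hcost => ?_⟩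
  · have h := hopt.trans_le (hlow.trans (add_le_add_right (hcap hν) _))
    rw [ENNReal.add_le_add_iff_right hfin.2, ENNReal.add_le_add_iff_left hfin.1.1] at h
    exact h
  -- all inequalities are equalities, so that `ν` is concentrated on the staircase
  have heq : ∀ j k, ∫⁻ s, (M + m.disutility j k s + p s) ∂ν j k
      ≤ ∫⁻ _, (U j + V k : ℝ≥0∞) ∂ν j k := by
    have htot : ∑ j, ∑ k, ∫⁻ s, (M + m.disutility j k s + p s) ∂ν j k
        ≤ ∑ j, ∑ k, ∫⁻ _, (U j + V k : ℝ≥0∞) ∂ν j k := by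
      rw [hsplit hν, hdual hν, ← hopt]
      exact add_le_add (add_le_add_right hcost _) (hcap hν)
    rw [← Finset.sum_product', ← Finset.sum_product'] at htot
    intro j k
    refine (ENNReal.eq_of_le_of_sum_le (fun q _ => lintegral_mono (hle q.1 q.2)) htot ?_
      (Finset.mk_mem_product (Finset.mem_univ j) (Finset.mem_univ k))).ge
    rw [Finset.sum_product, hdual hν]
    exact hDtop
  have hfinν : ∀ j k, ν j k univ ≠ ⊤ := fun j k => ne_top_of_le_ne_top
    (ENNReal.coe_ne_top (r := m.R j)) (hν.land j ▸ Finset.single_le_sum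
      (f := fun k => ν j k univ) (fun _ _ => zero_le) (Finset.mem_univ k))
  have hconc : ∀ j k, ∀ᵐ s ∂ν j k, s ∈ m.stairSet j k := by
    intro j k
    have hae' := ae_eq_of_ae_le_of_lintegral_le (Filter.Eventually.of_forall (hle j k))
      (by rw [lintegral_const]; exact ENNReal.mul_ne_top (by simp) (hfinν j k))
      ((measurable_const.add (hm.measurable_disutility j k)).add hp).aemeasurable (heq j k)
    filter_upwards [hae', haeν hν j k] with s h1 h2
    exact by_contra fun h => (h2.2 h).ne h1
  have hsum : ∑ j, ∑ k, ν j k = N₀ := by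
    have huniv : (∑ j, ∑ k, ν j k) univ = N₀ univ := by
      simp only [hN₀, Measure.finsetSum_apply, hν.land, hst.land]
    have : IsFiniteMeasure (∑ j, ∑ k, ν j k) := ⟨by
      simp only [Measure.finsetSum_apply, hν.land]
      exact ENNReal.sum_lt_top.2 fun j _ => ENNReal.coe_lt_top⟩
    refine Measure.eq_of_le_of_measure_univ_eq ?_ huniv
    have hres : (∑ j, ∑ k, ν j k).restrict (Ioc (-m.T) 0) = ∑ j, ∑ k, ν j k := by
      refine Measure.restrict_eq_self_of_ae_mem ?_
      rw [ae_iff]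
      simp only [Measure.finsetSum_apply, Finset.sum_eq_zero_iff]
      exact fun j _ k _ => measure_mono_null
        (t := {s | s ∉ m.stairSet j k}) (fun s hs h => hs h.1) (hconc j k)
    rw [← hres, hN₀, sum_stairFlow]
    exact Measure.restrict_mono_measure hν.capacity _
  funext j k
  rw [m.eq_restrict_of_ae_mem_stairSet hconc j k, hsum, hN₀]
  exact (m.eq_restrict_of_ae_mem_stairSet (ν := m.stairFlow)
    (fun j k => ae_restrict_mem (m.measurableSet_stairSet j k)) j k).symm

end Flow

section Problems

variable {J K : ℕ} (m : CommuteModel J K)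

/-! ### The linear program -/

/-- The flow measures of a pattern of departure rates on the horizon `S`. -/
noncomputable def rateFlow (S : Set ℝ) (x : Fin J → Fin K → ℝ → ℝ≥0) (j : Fin J) (k : Fin K) :
    Measure ℝ :=
  (volume.restrict S).withDensity fun s => (x j k s : ℝ≥0∞)

theorem rateFlow_univ (S : Set ℝ) (x : Fin J → Fin K → ℝ → ℝ≥0) (j : Fin J) (k : Fin K) :
    rateFlow S x j k univ = ∫⁻ s in S, (x j k s : ℝ≥0∞) := by
  rw [rateFlow, withDensity_apply _ MeasurableSet.univ, Measure.restrict_univ]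

variable {m}

/-- Since the supply of locations equals the demand for workers, a feasible pattern satisfies both
families of constraints with equality. -/
theorem Feasible.isFlow {S : Set ℝ} {x : Fin J → Fin K → ℝ → ℝ≥0} (h : m.Feasible S x)
    (hbal : ∑ j, m.R j = ∑ k, m.Q k) : m.IsFlow (rateFlow S x) := by
  have hRQ : ∑ j, (m.R j : ℝ≥0∞) = ∑ k, (m.Q k : ℝ≥0∞) := by exact_mod_cast hbal
  have hcomm : ∑ j, ∑ k, ∫⁻ s in S, (x j k s : ℝ≥0∞) = ∑ k, ∑ j, ∫⁻ s in S, (x j k s : ℝ≥0∞) :=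
    Finset.sum_comm
  have hland := Finset.sum_le_sum fun j (_ : j ∈ Finset.univ) => h.land j
  have hjob := Finset.sum_le_sum fun k (_ : k ∈ Finset.univ) => h.job k
  have hR : ∑ j, (m.R j : ℝ≥0∞) ≠ ⊤ := ENNReal.sum_ne_top.2 fun _ _ => ENNReal.coe_ne_top
  refine ⟨?_, fun j => ?_, fun k => ?_⟩
  · refine Measure.le_iff.2 fun A hA => ?_
    simp only [Measure.finsetSum_apply, rateFlow, withDensity_apply _ hA]
    have hmeas : ∀ j k, AEMeasurable (fun s => (x j k s : ℝ≥0∞))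
        ((volume.restrict S).restrict A) := fun j k =>
      (h.meas j k).coe_nnreal_ennreal.mono_measure Measure.restrict_le_self
    calc ∑ j, ∑ k, ∫⁻ s in A, (x j k s : ℝ≥0∞) ∂volume.restrict S
        = ∫⁻ s in A, ∑ j, ∑ k, (x j k s : ℝ≥0∞) ∂volume.restrict S := by
          rw [lintegral_finsetSum' _ fun j _ =>
            Finset.aemeasurable_fun_sum _ fun k _ => hmeas j k]
          exact Finset.sum_congr rfl fun j _ => (lintegral_finsetSum' _ fun k _ => hmeas j k).symm
      _ ≤ ∫⁻ _ in A, (m.μ : ℝ≥0∞) ∂volume.restrict S := by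
          refine lintegral_mono_ae (ae_restrict_of_ae (h.capacity.mono fun s hs => ?_))
          exact_mod_cast hs
      _ ≤ (m.μ • volume : Measure ℝ) A := by
          rw [setLIntegral_const, Measure.smul_apply, ENNReal.smul_def, smul_eq_mul]
          exact mul_le_mul_right (Measure.restrict_le_self A) _
  · simp only [rateFlow_univ]
    exact ENNReal.eq_of_le_of_sum_le (fun j _ => h.land j)
      (by rw [hRQ, hcomm]; exact hjob) (ne_top_of_le_ne_top hR hland) (Finset.mem_univ j)
  · simp only [rateFlow_univ]
    exact (ENNReal.eq_of_le_of_sum_le (fun k _ => h.job k)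
      (by rw [← hRQ, ← hcomm]; exact hland) (hRQ ▸ hR) (Finset.mem_univ k)).symm

theorem totalDisutility_eq_flowCost [NeZero J] (hm : m.Assumption) {S : Set ℝ}
    {x : Fin J → Fin K → ℝ → ℝ≥0} (h : m.Feasible S x) :
    m.totalDisutility S x = m.flowCost (rateFlow S x) := by
  refine Finset.sum_congr rfl fun j _ => Finset.sum_congr rfl fun k _ => ?_
  rw [rateFlow, lintegral_withDensity_eq_lintegral_mul₀ (h.meas j k).coe_nnreal_ennreal
    (hm.measurable_disutility j k).aemeasurable]
  exact lintegral_congr fun s => mul_comm _ _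

variable (m) [NeZero J] [NeZero K]

/-- The departure rates of the comonotone flow. -/
noncomputable def stairRate (j : Fin J) (k : Fin K) : ℝ → ℝ≥0 :=
  (m.stairSet j k).indicator fun _ => m.μ

theorem coe_stairRate (j : Fin J) (k : Fin K) :
    (fun s => (m.stairRate j k s : ℝ≥0∞)) = (m.stairSet j k).indicator fun _ => (m.μ : ℝ≥0∞) := by
  ext s
  by_cases hs : s ∈ m.stairSet j k <;> simp [stairRate, hs]

theorem rateFlow_stairRate {S : Set ℝ} (hTS : Icc (-m.T) 0 ⊆ S) :
    rateFlow S m.stairRate = m.stairFlow := by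
  funext j k
  have hsub : m.stairSet j k ⊆ S := fun s hs => hTS ⟨hs.1.1.le, hs.1.2⟩
  rw [rateFlow, coe_stairRate, withDensity_indicator (m.measurableSet_stairSet j k),
    Measure.restrict_restrict_of_subset hsub, withDensity_const, stairFlow, Measure.restrict_smul]
  rfl

theorem feasible_stairRate (hμ : 0 < m.μ) (hbal : ∑ j, m.R j = ∑ k, m.Q k) {S : Set ℝ}
    (hTS : Icc (-m.T) 0 ⊆ S) : m.Feasible S m.stairRate := by
  have h := m.isFlow_stairFlow hμ hbal
  rw [← m.rateFlow_stairRate hTS] at h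
  refine ⟨fun j k => (measurable_const.indicator (m.measurableSet_stairSet j k)).aemeasurable,
    .of_forall fun s => ?_, fun j => ?_, fun k => ?_⟩
  · calc ∑ j, ∑ k, m.stairRate j k s
        ≤ ∑ j, ∑ k, if j = m.classAt m.R s then (if k = m.classAt m.Q s then m.μ else 0) else 0 := by
          refine Finset.sum_le_sum fun j _ => Finset.sum_le_sum fun k _ => ?_
          by_cases hs : s ∈ m.stairSet j k
          · simp [stairRate, hs, hs.2.1, hs.2.2]
          · simp [stairRate, hs]
      _ = m.μ := by simp
  · simpa only [rateFlow_univ] using (h.land j).le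
  · simpa only [rateFlow_univ] using (h.job k).ge

theorem flowCDF_stairRate (hμ : 0 < m.μ) (hbal : ∑ j, m.R j = ∑ k, m.Q k) {ζ κ s : ℝ}
    (hζ : ζ ∈ Icc (1 : ℝ) J) (hκ : κ ∈ Icc (1 : ℝ) K) (hs : s ≤ 0) :
    m.flowCDF m.stairRate ζ κ s = ENNReal.ofReal (m.frechetHoeffding ζ κ s) := by
  rw [← m.sum_stairFlow_Iic hμ hbal hζ hκ hs]
  refine Finset.sum_congr rfl fun j _ => Finset.sum_congr rfl fun k _ => ?_
  rw [coe_stairRate, lintegral_indicator (m.measurableSet_stairSet j k), setLIntegral_const,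
    Measure.restrict_apply (m.measurableSet_stairSet j k), stairFlow,
    Measure.restrict_apply measurableSet_Iic, Measure.smul_apply, ENNReal.smul_def, smul_eq_mul]
  congr 2
  ext t
  simp only [mem_inter_iff, mem_Icc, mem_Iic]
  exact ⟨fun h => ⟨h.2.2, h.1⟩, fun h => ⟨h.2, h.2.1.1.le, h.1⟩⟩

/-- The comonotone pattern is the unique solution of the linear program. -/
theorem isLPSolution_stairRate (hμ : 0 < m.μ) (hbal : ∑ j, m.R j = ∑ k, m.Q k)
    (hm : m.Assumption) {S : Set ℝ} (hTS : Icc (-m.T) 0 ⊆ S) :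
    m.IsLPSolution S m.stairRate ∧ ∀ y : Fin J → Fin K → ℝ → ℝ≥0, m.IsLPSolution S y →
      ∀ j k, y j k =ᵐ[volume.restrict S] m.stairRate j k := by
  have hfeas := m.feasible_stairRate hμ hbal hTS
  have hst := totalDisutility_eq_flowCost hm hfeas
  rw [m.rateFlow_stairRate hTS] at hst
  refine ⟨⟨hfeas, fun y hy => ?_⟩, fun y hy j k => ?_⟩
  · change m.totalDisutility S m.stairRate ≤ m.totalDisutility S y
    rw [hst, totalDisutility_eq_flowCost hm hy]
    exact (m.flowCost_stairFlow hμ hbal hm (hy.isFlow hbal)).2.1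
  · have hle : m.totalDisutility S y ≤ m.totalDisutility S m.stairRate := hy.2 hfeas
    rw [hst, totalDisutility_eq_flowCost hm hy.1] at hle
    have heq := (m.flowCost_stairFlow hμ hbal hm (hy.1.isFlow hbal)).2.2 hle
    rw [← m.rateFlow_stairRate hTS] at heq
    have h := (withDensity_eq_iff_of_sigmaFinite (hy.1.meas j k).coe_nnreal_ennreal
      (hfeas.meas j k).coe_nnreal_ennreal).1 (congrFun (congrFun heq j) k)
    exact h.mono fun s hs => ENNReal.coe_injective hs

/-! ### The transport problem -/

/-- The measure on the box whose fibre over the integer point `(j, k)` is `ν j k`. -/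
noncomputable def flowPlan (ν : Fin J → Fin K → Measure ℝ) : Measure (ℝ × ℝ × ℝ) :=
  ∑ j, ∑ k, (ν j k).map fun s => ((j : ℝ) + 1, (k : ℝ) + 1, s)

/-- The fibre `{j} × {k} × ℝ`, with `j` and `k` numbered from `1`. -/
def fibre (j : Fin J) (k : Fin K) : Set (ℝ × ℝ × ℝ) :=
  {(j : ℝ) + 1} ×ˢ {(k : ℝ) + 1} ×ˢ univ

/-- The flow measures of a plan: the time marginals of its restrictions to the fibres. Mass off the
fibres is dropped. -/
noncomputable def planFlow (ρ : Measure (ℝ × ℝ × ℝ)) (j : Fin J) (k : Fin K) : Measure ℝ :=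
  (ρ.restrict (fibre j k)).map fun p => p.2.2

omit [NeZero J] [NeZero K] in
theorem measurableSet_fibre (j : Fin J) (k : Fin K) : MeasurableSet (fibre j k) :=
  (measurableSet_singleton _).prod ((measurableSet_singleton _).prod MeasurableSet.univ)

omit [NeZero J] [NeZero K] in
theorem measurableEmbedding_fibre (j : Fin J) (k : Fin K) :
    MeasurableEmbedding fun s : ℝ => ((j : ℝ) + 1, (k : ℝ) + 1, s) :=
  (measurableEmbedding_prodMk_left _).prodMk_left _

omit [NeZero J] [NeZero K] in
theorem measCDF_flowPlan (ν : Fin J → Fin K → Measure ℝ) (ζ κ s : ℝ) :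
    measCDF (flowPlan ν) ζ κ s = ∑ j ∈ upTo J ζ, ∑ k ∈ upTo K κ, ν j k (Iic s) := by
  simp only [measCDF, flowPlan, Measure.finsetSum_apply, (measurableEmbedding_fibre _ _).map_apply,
    upTo, Finset.sum_filter]
  refine Finset.sum_congr rfl fun j _ => ?_
  by_cases hj : (j : ℝ) + 1 ≤ ζ
  · simp only [hj, if_true]
    refine Finset.sum_congr rfl fun k _ => ?_
    by_cases hk : (k : ℝ) + 1 ≤ κ
    · simp only [hk, if_true]
      congr 1
      ext t
      simp [hj, hk]
    · simp [hk, preimage]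
  · simp [hj, preimage]

/-- A measure on `[1, N]` whose distribution function is the step function of the masses `q` is the
sum of the corresponding point masses. -/
theorem eq_sum_dirac {N : ℕ} [NeZero N] {q : Fin N → ℝ≥0} {lam : Measure ℝ}
    (hsupp : lam (Icc (1 : ℝ) N)ᶜ = 0)
    (h : ∀ ζ ∈ Icc (1 : ℝ) N, lam (Iic ζ) = ENNReal.ofReal (∑ i ∈ upTo N ζ, (q i : ℝ))) :
    lam = ∑ i : Fin N, q i • Measure.dirac ((i : ℝ) + 1) := by
  have hN : (1 : ℝ) ≤ N := by exact_mod_cast NeZero.one_le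
  have hsum : ∀ a : ℝ, (∑ i : Fin N, q i • Measure.dirac ((i : ℝ) + 1)) (Iic a)
      = ENNReal.ofReal (∑ i ∈ upTo N a, (q i : ℝ)) := by
    intro a
    rw [← NNReal.coe_sum, ENNReal.ofReal_coe_nnreal, ENNReal.ofNNReal_finsetSum, upTo,
      Finset.sum_filter, Measure.finsetSum_apply]
    refine Finset.sum_congr rfl fun i _ => ?_
    rw [Measure.smul_apply, Measure.dirac_apply' _ measurableSet_Iic, ENNReal.smul_def]
    by_cases hi : (i : ℝ) + 1 ≤ a <;> simp [hi]
  refine (Measure.ext_of_Iic _ _ fun a => ?_).symm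
  rw [hsum]
  rcases lt_or_ge a 1 with ha | ha
  · rw [measure_mono_null (t := (Icc (1 : ℝ) N)ᶜ) (fun x hx hx' => ?_) hsupp]
    · have : upTo N a = ∅ := Finset.filter_eq_empty_iff.2 fun i _ => by
        have := Nat.cast_nonneg (α := ℝ) i.val
        exact not_le.2 (by linarith)
      simp [this]
    · exact absurd (hx'.1.trans hx) (not_le.2 ha)
  rcases le_or_gt a N with ha' | ha'
  · exact (h a ⟨ha, ha'⟩).symm
  · have h1 : lam (Iic a) = lam (Iic (N : ℝ)) := by
      refine measure_congr ?_
      filter_upwards [show ∀ᵐ x ∂lam, x ∈ Icc (1 : ℝ) N from hsupp] with x hx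
      exact propext ⟨fun _ => hx.2, fun _ => hx.2.trans ha'.le⟩
    have h2 : upTo N a = upTo N (N : ℝ) := by
      refine Finset.filter_congr fun i _ => ?_
      have : (i : ℝ) + 1 ≤ N := by exact_mod_cast i.2
      exact ⟨fun _ => this, fun _ => this.trans ha'.le⟩
    rw [h1, h2, h N ⟨hN, le_rfl⟩]

theorem sum_dirac_singleton {N : ℕ} (q : Fin N → ℝ≥0) (i : Fin N) :
    (∑ i : Fin N, q i • Measure.dirac ((i : ℝ) + 1)) {(i : ℝ) + 1} = q i := by
  rw [Measure.finsetSum_apply, Finset.sum_eq_single i]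
  · rw [Measure.smul_apply, Measure.dirac_apply' _ (measurableSet_singleton _),
      indicator_of_mem (mem_singleton _), ENNReal.smul_def, Pi.one_apply, smul_eq_mul, mul_one]
  · intro i' _ hi
    have hne : ((i' : ℕ) : ℝ) + 1 ∉ ({(i : ℝ) + 1} : Set ℝ) := fun h =>
      hi (Fin.ext (Nat.cast_injective (add_right_cancel (mem_singleton_iff.1 h))))
    rw [Measure.smul_apply, Measure.dirac_apply' _ (measurableSet_singleton _),
      indicator_of_notMem hne, smul_zero]
  · exact fun h => absurd (Finset.mem_univ i) h

variable {m}

namespace IsPlan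

variable {ρ : Measure (ℝ × ℝ × ℝ)} (h : m.IsPlan ρ)
include h

omit [NeZero J] [NeZero K] in
theorem ae_mem_box : ∀ᵐ p ∂ρ, p ∈ m.box := h.supp

omit [NeZero K] in
theorem map_land : ρ.map Prod.fst = ∑ j : Fin J, m.R j • Measure.dirac ((j : ℝ) + 1) := by
  refine eq_sum_dirac ?_ fun ζ hζ => ?_
  · rw [Measure.map_apply measurable_fst measurableSet_Icc.compl]
    exact measure_mono_null (t := m.boxᶜ) (fun p hp hp' => hp hp'.1) h.supp
  · rw [← h.land ζ hζ, Measure.map_apply measurable_fst measurableSet_Iic, measCDF]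
    refine measure_congr ?_
    filter_upwards [h.ae_mem_box] with p hp
    exact propext ⟨fun hp' => ⟨hp', hp.2.1.2, hp.2.2.2⟩, fun hp' => hp'.1⟩

omit [NeZero J] in
theorem map_job :
    ρ.map (fun p => p.2.1) = ∑ k : Fin K, m.Q k • Measure.dirac ((k : ℝ) + 1) := by
  have hmeas : Measurable fun p : ℝ × ℝ × ℝ => p.2.1 := by fun_prop
  refine eq_sum_dirac ?_ fun κ hκ => ?_
  · rw [Measure.map_apply hmeas measurableSet_Icc.compl]
    exact measure_mono_null (t := m.boxᶜ) (fun p hp hp' => hp hp'.2.1) h.supp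
  · rw [← h.job κ hκ, Measure.map_apply hmeas measurableSet_Iic, measCDF]
    refine measure_congr ?_
    filter_upwards [h.ae_mem_box] with p hp
    exact propext ⟨fun hp' => ⟨hp.1.2, hp', hp.2.2.2⟩, fun hp' => hp'.2.1⟩

omit [NeZero J] [NeZero K] in
theorem map_time :
    ρ.map (fun p => p.2.2) = (m.μ • volume : Measure ℝ).restrict (Icc (-m.T) 0) := by
  have hmeas : Measurable fun p : ℝ × ℝ × ℝ => p.2.2 := by fun_prop
  have hT := m.T_nonneg
  have hcdf : ∀ s ∈ Icc (-m.T) 0, ρ.map (fun p => p.2.2) (Iic s)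
      = (m.μ • volume : Measure ℝ).restrict (Icc (-m.T) 0) (Iic s) := by
    intro s hs
    rw [Measure.map_apply hmeas measurableSet_Iic, Measure.restrict_smul,
      ← restrict_Ioc_eq_restrict_Icc, ← Measure.restrict_smul,
      Measure.restrict_apply measurableSet_Iic]
    have hset : Iic s ∩ Ioc (-m.T) 0 = Ioc (-m.T) s := by
      ext t
      exact ⟨fun ht => ⟨ht.2.1, ht.1⟩, fun ht => ⟨ht.2, ht.1, ht.2.trans hs.2⟩⟩
    rw [hset, smul_volume_Ioc, sub_neg_eq_add, add_comm s, ← h.time s hs, measCDF]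
    refine measure_congr ?_
    filter_upwards [h.ae_mem_box] with p hp
    exact propext ⟨fun hp' => ⟨hp.1.2, hp.2.1.2, hp'⟩, fun hp' => hp'.2.2⟩
  have : IsFiniteMeasure ((m.μ • volume : Measure ℝ).restrict (Icc (-m.T) 0)) := by
    rw [Measure.restrict_smul]
    infer_instance
  refine (Measure.ext_of_Iic _ _ fun a => ?_).symm
  rcases lt_or_ge a (-m.T) with ha | ha
  · rw [Measure.map_apply hmeas measurableSet_Iic, Measure.restrict_apply measurableSet_Iic,
      measure_mono_null (t := m.boxᶜ) (fun p hp hp' => ?_) h.supp]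
    · rw [(Set.disjoint_left.2 fun t ht ht' => ?_ : Disjoint (Iic a) (Icc (-m.T) 0)).inter_eq,
        measure_empty]
      exact absurd (ht'.1.trans ht) (not_le.2 ha)
    · exact absurd (hp'.2.2.1.trans hp) (not_le.2 ha)
  rcases le_or_gt a 0 with ha' | ha'
  · exact (hcdf a ⟨ha, ha'⟩).symm
  · have h1 : (m.μ • volume : Measure ℝ).restrict (Icc (-m.T) 0) (Iic a)
        = (m.μ • volume : Measure ℝ).restrict (Icc (-m.T) 0) (Iic 0) := by
      refine measure_congr ?_
      filter_upwards [ae_restrict_mem measurableSet_Icc] with x hx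
      exact propext ⟨fun _ => hx.2, fun _ => hx.2.trans ha'.le⟩
    rw [h1, ← hcdf 0 ⟨by linarith, le_rfl⟩, Measure.map_apply hmeas measurableSet_Iic,
      Measure.map_apply hmeas measurableSet_Iic]
    refine measure_congr ?_
    filter_upwards [h.ae_mem_box] with p hp
    exact propext ⟨fun _ => hp.2.2.2.trans ha'.le, fun _ => hp.2.2.2⟩

/-- Every plan is concentrated on the fibres over the integer points. -/
theorem sum_restrict_fibre : ∑ j : Fin J, ∑ k : Fin K, ρ.restrict (fibre j k) = ρ := by
  have hae : ∀ {N : ℕ} (q : Fin N → ℝ≥0),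
      ∀ᵐ x ∂(∑ i : Fin N, q i • Measure.dirac ((i : ℝ) + 1)), ∃ i : Fin N, (i : ℝ) + 1 = x := by
    intro N q
    rw [ae_finsetSum_measure_iff]
    exact fun i _ => Measure.ae_smul_measure
      ((ae_dirac_iff (Set.finite_range fun i : Fin N => (i : ℝ) + 1).measurableSet).2 ⟨i, rfl⟩) _
  have h1 : ∀ᵐ p ∂ρ, ∃ j : Fin J, (j : ℝ) + 1 = p.1 :=
    ae_of_ae_map measurable_fst.aemeasurable (h.map_land ▸ hae m.R)
  have h2 : ∀ᵐ p ∂ρ, ∃ k : Fin K, (k : ℝ) + 1 = p.2.1 :=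
    ae_of_ae_map (f := fun p : ℝ × ℝ × ℝ => p.2.1) (by fun_prop) (h.map_job ▸ hae m.Q)
  ext A hA
  simp only [Measure.finsetSum_apply, Measure.restrict_apply hA]
  rw [← Finset.sum_product',
    ← measure_biUnion_finset (f := fun q : Fin J × Fin K => A ∩ fibre q.1 q.2)]
  · refine measure_congr ?_
    filter_upwards [h1, h2] with p ⟨j, hj⟩ ⟨k, hk⟩
    refine propext ⟨fun hp => ?_, fun hp => ?_⟩
    · obtain ⟨q, -, hq⟩ := mem_iUnion₂.1 hp
      exact hq.1
    · exact mem_iUnion₂.2 ⟨(j, k), by simp, hp, hj.symm, hk.symm, mem_univ _⟩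
  · rintro ⟨j, k⟩ - ⟨j', k'⟩ - hne
    refine Set.disjoint_left.2 fun p hp hp' => hne ?_
    have e1 : (j : ℝ) + 1 = j' + 1 := hp.2.1.symm.trans hp'.2.1
    have e2 : (k : ℝ) + 1 = k' + 1 := hp.2.2.1.symm.trans hp'.2.2.1
    simpa [Prod.ext_iff, Fin.ext_iff] using And.intro e1 e2
  · exact fun q _ => hA.inter (measurableSet_fibre _ _)

theorem eq_flowPlan : ρ = flowPlan (planFlow (J := J) (K := K) ρ) := by
  conv_lhs => rw [← h.sum_restrict_fibre]
  refine Finset.sum_congr rfl fun j _ => Finset.sum_congr rfl fun k _ => ?_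
  rw [planFlow, Measure.map_map (measurableEmbedding_fibre j k).measurable (by fun_prop)]
  refine Measure.map_id.symm.trans (Measure.map_congr ?_)
  filter_upwards [ae_restrict_mem (measurableSet_fibre j k)] with p hp
  exact Prod.ext hp.1 (Prod.ext hp.2.1 rfl)

theorem isFlow_planFlow : m.IsFlow (planFlow (J := J) (K := K) ρ) := by
  have hmeas : Measurable fun p : ℝ × ℝ × ℝ => p.2.2 := by fun_prop
  have hmeas' : Measurable fun p : ℝ × ℝ × ℝ => p.2.1 := by fun_prop
  have huniv : ∀ j k, planFlow (J := J) (K := K) ρ j k univ = ρ (fibre j k) := fun j k => by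
    rw [planFlow, Measure.map_apply hmeas MeasurableSet.univ, preimage_univ,
      Measure.restrict_apply_univ]
  refine ⟨?_, fun j => ?_, fun k => ?_⟩
  · have : ∑ j, ∑ k, planFlow (J := J) (K := K) ρ j k = ρ.map fun p => p.2.2 := by
      conv_rhs => rw [← h.sum_restrict_fibre]
      ext A hA
      rw [Measure.map_apply hmeas hA]
      simp only [Measure.finsetSum_apply, planFlow, Measure.map_apply hmeas hA]
    rw [this, h.map_time]
    exact Measure.restrict_le_self
  · have hj : ρ.map Prod.fst {(j : ℝ) + 1} = m.R j := by
      rw [h.map_land, sum_dirac_singleton]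
    rw [← hj, Measure.map_apply measurable_fst (measurableSet_singleton _)]
    conv_rhs => rw [← h.sum_restrict_fibre]
    simp only [Measure.finsetSum_apply]
    rw [Finset.sum_eq_single j]
    · refine Finset.sum_congr rfl fun k _ => ?_
      rw [huniv, Measure.restrict_apply (measurable_fst (measurableSet_singleton _)),
        inter_eq_right.2 fun p hp => hp.1]
    · intro i _ hij
      refine Finset.sum_eq_zero fun k _ => ?_
      rw [Measure.restrict_apply (measurable_fst (measurableSet_singleton _)),
        (Set.disjoint_left.2 fun p hp hp' => hij ?_ : Disjoint _ (fibre i k)).inter_eq,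
        measure_empty]
      have e : (i : ℝ) + 1 = j + 1 := hp'.1.symm.trans hp
      simpa [Fin.ext_iff] using e
    · simp
  · have hk : ρ.map (fun p => p.2.1) {(k : ℝ) + 1} = m.Q k := by
      rw [h.map_job, sum_dirac_singleton]
    rw [← hk, Measure.map_apply hmeas' (measurableSet_singleton _)]
    conv_rhs => rw [← h.sum_restrict_fibre]
    simp only [Measure.finsetSum_apply]
    refine Finset.sum_congr rfl fun j _ => ?_
    rw [Finset.sum_eq_single k]
    · rw [huniv, Measure.restrict_apply (hmeas' (measurableSet_singleton _)),
        inter_eq_right.2 fun p hp => hp.2.1]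
    · intro i _ hik
      rw [Measure.restrict_apply (hmeas' (measurableSet_singleton _)),
        (Set.disjoint_left.2 fun p hp hp' => hik ?_ : Disjoint _ (fibre j i)).inter_eq,
        measure_empty]
      have e : (i : ℝ) + 1 = k + 1 := hp'.2.1.symm.trans hp
      simpa [Fin.ext_iff] using e
    · simp

omit [NeZero J] [NeZero K] in
theorem ae_planFlow_mem (j : Fin J) (k : Fin K) :
    ∀ᵐ s ∂planFlow ρ j k, s ∈ Icc (-m.T) 0 := by
  refine (ae_map_iff (by fun_prop) measurableSet_Icc).2 ?_
  exact ae_restrict_of_ae (h.ae_mem_box.mono fun p hp => hp.2.2)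

end IsPlan

omit [NeZero K] in
/-- On `[-T, 0]` the disutility is at most its value at `-T`. -/
theorem flowCost_ne_top (hm : m.Assumption) {ν : Fin J → Fin K → Measure ℝ} (hν : m.IsFlow ν)
    (hsupp : ∀ j k, ∀ᵐ s ∂ν j k, s ∈ Icc (-m.T) 0) : m.flowCost ν ≠ ⊤ := by
  refine ENNReal.sum_ne_top.2 fun j _ => ENNReal.sum_ne_top.2 fun k _ => ?_
  have hfin : ν j k univ ≠ ⊤ := ne_top_of_le_ne_top (ENNReal.coe_ne_top (r := m.R j))
    (hν.land j ▸ Finset.single_le_sum (f := fun k => ν j k univ) (fun _ _ => zero_le)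
      (Finset.mem_univ k))
  have hT : -m.T ≤ 0 := by linarith [m.T_nonneg]
  refine ne_top_of_le_ne_top (b := ENNReal.ofReal (m.cost j k (-m.T)) * ν j k univ)
    (ENNReal.mul_ne_top ENNReal.ofReal_ne_top hfin) ?_
  rw [← lintegral_const]
  refine lintegral_mono_ae ((hsupp j k).mono fun s hs => ?_)
  rw [hm.disutility_eq j k hs.2]
  exact ENNReal.ofReal_le_ofReal ((hm.cost_strictAntiOn j k).antitoneOn hT hs.2 hs.1)

omit [NeZero J] [NeZero K] in
theorem flowPlan_box_compl {ν : Fin J → Fin K → Measure ℝ}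
    (hsupp : ∀ j k, ∀ᵐ s ∂ν j k, s ∈ Icc (-m.T) 0) : flowPlan ν m.boxᶜ = 0 := by
  simp only [flowPlan, Measure.finsetSum_apply, (measurableEmbedding_fibre _ _).map_apply,
    Finset.sum_eq_zero_iff]
  refine fun j _ k _ => measure_mono_null (t := (Icc (-m.T) 0)ᶜ) (fun s hs hs' => hs ?_) (hsupp j k)
  have hj : (j : ℝ) + 1 ≤ J := by exact_mod_cast j.2
  have hk : (k : ℝ) + 1 ≤ K := by exact_mod_cast k.2
  exact ⟨⟨by simp, hj⟩, ⟨by simp, hk⟩, hs'⟩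

omit [NeZero K] in
theorem integral_flowPlan (hm : m.Assumption) {c : ℝ × ℝ × ℝ → ℝ} (hc : m.Extends c)
    {ν : Fin J → Fin K → Measure ℝ} (hsupp : ∀ j k, ∀ᵐ s ∂ν j k, s ∈ Icc (-m.T) 0)
    (hfin : m.flowCost ν ≠ ⊤) :
    ∫ p in m.box, c p ∂flowPlan ν = (m.flowCost ν).toReal := by
  rw [Measure.restrict_eq_self_of_ae_mem
    (show ∀ᵐ p ∂flowPlan ν, p ∈ m.box from flowPlan_box_compl hsupp)]
  have hfin1 : ∀ j, ∑ k, ∫⁻ s, m.disutility j k s ∂ν j k ≠ ⊤ := fun j =>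
    ENNReal.sum_ne_top.1 hfin j (Finset.mem_univ j)
  have hfin2 : ∀ j k, ∫⁻ s, m.disutility j k s ∂ν j k ≠ ⊤ := fun j k =>
    ENNReal.sum_ne_top.1 (hfin1 j) k (Finset.mem_univ k)
  have hcongr : ∀ j k, (fun s => c ((j : ℝ) + 1, (k : ℝ) + 1, s))
      =ᵐ[ν j k] fun s => (m.disutility j k s).toReal := fun j k =>
    (hsupp j k).mono fun s hs => hc j k s hs
  have hint : ∀ j k, Integrable c ((ν j k).map fun s => ((j : ℝ) + 1, (k : ℝ) + 1, s)) :=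
    fun j k => ((measurableEmbedding_fibre j k).integrable_map_iff).2
      ((integrable_toReal_of_lintegral_ne_top (hm.measurable_disutility j k).aemeasurable
        (hfin2 j k)).congr (hcongr j k).symm)
  rw [flowPlan, integral_finsetSum_measure fun j _ =>
    integrable_finsetSum_measure.2 fun k _ => hint j k, flowCost,
    ENNReal.toReal_sum fun j _ => hfin1 j]
  refine Finset.sum_congr rfl fun j _ => ?_
  rw [integral_finsetSum_measure fun k _ => hint j k, ENNReal.toReal_sum fun k _ => hfin2 j k]
  refine Finset.sum_congr rfl fun k _ => ?_
  rw [(measurableEmbedding_fibre j k).integral_map, integral_congr_ae (hcongr j k),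
    integral_toReal (hm.measurable_disutility j k).aemeasurable
      (ae_lt_top (hm.measurable_disutility j k) (hfin2 j k))]

variable (m)

theorem ae_stairFlow_mem (j : Fin J) (k : Fin K) : ∀ᵐ s ∂m.stairFlow j k, s ∈ Icc (-m.T) 0 :=
  (ae_restrict_mem (m.measurableSet_stairSet j k)).mono fun _ hs => ⟨hs.1.1.le, hs.1.2⟩

theorem isPlan_flowPlan_stairFlow (hμ : 0 < m.μ) (hbal : ∑ j, m.R j = ∑ k, m.Q k) :
    m.IsPlan (flowPlan m.stairFlow) := by
  have hJ : (J : ℝ) ∈ Icc (1 : ℝ) J := ⟨by exact_mod_cast NeZero.one_le, le_rfl⟩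
  have hK : (K : ℝ) ∈ Icc (1 : ℝ) K := ⟨by exact_mod_cast NeZero.one_le, le_rfl⟩
  have hall : ∀ N : ℕ, upTo N (N : ℝ) = Finset.univ := fun N =>
    Finset.filter_true_of_mem fun i _ => by exact_mod_cast i.2
  have hRQ : ∑ j, (m.R j : ℝ) = ∑ k, (m.Q k : ℝ) := by exact_mod_cast hbal
  have hle : ∀ {N : ℕ} (q : Fin N → ℝ≥0) (x : ℝ), ∑ i ∈ upTo N x, (q i : ℝ) ≤ ∑ i, (q i : ℝ) :=
    fun q x => Finset.sum_le_sum_of_subset_of_nonneg (Finset.subset_univ _)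
      fun _ _ _ => NNReal.coe_nonneg _
  refine ⟨flowPlan_box_compl m.ae_stairFlow_mem, fun ζ hζ => ?_, fun κ hκ => ?_, fun s hs => ?_⟩
  · rw [measCDF_flowPlan, m.sum_stairFlow_Iic hμ hbal hζ hK le_rfl, frechetHoeffding, hall,
      add_zero, mul_T hμ, min_self, min_eq_left ((hle m.R ζ).trans_eq hRQ)]
  · rw [measCDF_flowPlan, m.sum_stairFlow_Iic hμ hbal hJ hκ le_rfl, frechetHoeffding, hall,
      add_zero, mul_T hμ, min_eq_left (hle m.Q κ), hRQ, min_eq_right (hle m.Q κ)]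
  · have : (m.μ : ℝ) * (m.T + s) ≤ ∑ k, (m.Q k : ℝ) := by
      rw [← mul_T hμ]
      exact mul_le_mul_of_nonneg_left (by linarith [hs.2]) m.μ.2
    rw [measCDF_flowPlan, m.sum_stairFlow_Iic hμ hbal hJ hK hs.2, frechetHoeffding, hall, hall,
      hRQ, min_eq_right this, min_eq_right this]

/-- The comonotone plan is the unique solution of the transport problem. -/
theorem isOTSolution_flowPlan_stairFlow (hμ : 0 < m.μ) (hbal : ∑ j, m.R j = ∑ k, m.Q k)
    (hm : m.Assumption) {c : ℝ × ℝ × ℝ → ℝ} (hc : m.Extends c) :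
    m.IsOTSolution c (flowPlan m.stairFlow) ∧
      ∀ ρ : Measure (ℝ × ℝ × ℝ), m.IsOTSolution c ρ → ρ = flowPlan m.stairFlow := by
  have hplan := m.isPlan_flowPlan_stairFlow hμ hbal
  have hst := integral_flowPlan hm hc m.ae_stairFlow_mem
    (flowCost_ne_top hm (m.isFlow_stairFlow hμ hbal) m.ae_stairFlow_mem)
  have hρ : ∀ {ρ : Measure (ℝ × ℝ × ℝ)}, m.IsPlan ρ →
      m.flowCost (planFlow ρ) ≠ ⊤ ∧ ∫ p in m.box, c p ∂ρ = (m.flowCost (planFlow ρ)).toReal := by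
    intro ρ h
    have hfin := flowCost_ne_top hm h.isFlow_planFlow h.ae_planFlow_mem
    refine ⟨hfin, ?_⟩
    rw [← integral_flowPlan hm hc h.ae_planFlow_mem hfin, ← h.eq_flowPlan]
  refine ⟨⟨hplan, fun ρ h => ?_⟩, fun ρ h => ?_⟩
  · change ∫ p in m.box, c p ∂flowPlan m.stairFlow ≤ ∫ p in m.box, c p ∂ρ
    rw [hst, (hρ h).2]
    exact ENNReal.toReal_mono (hρ h).1
      (m.flowCost_stairFlow hμ hbal hm (IsPlan.isFlow_planFlow h)).2.1
  · have hle : ∫ p in m.box, c p ∂ρ ≤ ∫ p in m.box, c p ∂flowPlan m.stairFlow := h.2 hplan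
    have hopt := m.flowCost_stairFlow hμ hbal hm h.1.isFlow_planFlow
    rw [hst, (hρ h.1).2, ENNReal.toReal_le_toReal (hρ h.1).1 hopt.1] at hle
    rw [h.1.eq_flowPlan, hopt.2.2 hle]

end Problems

end CommuteModel

theorem proposition7p2 {J K : ℕ} [NeZero J] [NeZero K] (m : CommuteModel J K)
    (hμ : 0 < m.μ) (hbal : ∑ j, m.R j = ∑ k, m.Q k) (hm : m.Assumption)
    (S : Set ℝ) (hS : MeasurableSet S) (hTS : Icc (-m.T) 0 ⊆ S) :
    (∃ x : Fin J → Fin K → ℝ → ℝ≥0, m.IsLPSolution S x ∧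
      (∀ ζ ∈ Icc (1 : ℝ) J, ∀ κ ∈ Icc (1 : ℝ) K, ∀ s ∈ Icc (-m.T) 0,
        m.flowCDF x ζ κ s = ENNReal.ofReal (m.frechetHoeffding ζ κ s)) ∧
      ∀ y : Fin J → Fin K → ℝ → ℝ≥0, m.IsLPSolution S y →
        ∀ j k, y j k =ᵐ[volume.restrict S] x j k) ∧
    ∀ c : ℝ × ℝ × ℝ → ℝ, m.Extends c →
      ∃ π : Measure (ℝ × ℝ × ℝ), m.IsOTSolution c π ∧
        (∀ ζ ∈ Icc (1 : ℝ) J, ∀ κ ∈ Icc (1 : ℝ) K, ∀ s ∈ Icc (-m.T) 0,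
          CommuteModel.measCDF π ζ κ s = ENNReal.ofReal (m.frechetHoeffding ζ κ s)) ∧
        ∀ ρ : Measure (ℝ × ℝ × ℝ), m.IsOTSolution c ρ → ρ = π := by
  obtain ⟨hsol, huniq⟩ := m.isLPSolution_stairRate hμ hbal hm hTS
  refine ⟨⟨m.stairRate, hsol, fun ζ hζ κ hκ s hs => m.flowCDF_stairRate hμ hbal hζ hκ hs.2, huniq⟩,
    fun c hc => ?_⟩
  obtain ⟨hsol, huniq⟩ := m.isOTSolution_flowPlan_stairFlow hμ hbal hm hc
  refine ⟨CommuteModel.flowPlan m.stairFlow, hsol, fun ζ hζ κ hκ s hs => ?_, huniq⟩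
  rw [CommuteModel.measCDF_flowPlan, m.sum_stairFlow_Iic hμ hbal hζ hκ hs.2]
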